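/- Let $n,m_1,m_2\geq 1$ be integers with $m_1,m_2$ coprime, let $d=\frac{m_1-m_2}{m_1+m_2}$, and let $\mathbf t=(1,n+1)$. A real polynomial in $x,y$ is called quasi-homogeneous of type $\mathbf t$ and degree $k$ if all its monomials $x^ay^b$ satisfy $a+(n+1)b=k$; a polynomial vector field $(P,Q)^T$ is called quasi-homogeneous of type $\mathbf t$ and degree $j$ if $P$ and $Q$ are quasi-homogeneous of type $\mathbf t$ and degrees $j+1$ and $j+n+1$, respectively (the zero polynomial has every degree). Let $\mathbf F$ be a real planar vector field, analytic at the origin, with quasi-homogeneous expansion $\mathbf F=\sum_{j\geq n}\mathbf F_j$ near the origin, where $\mathbf F_j$ is quasi-homogeneous of type $\mathbf t$ and degree $j$ and $$\mathbf F_n=\begin{pmatrix} y+dx^{n+1}\\ (n+1)x^{2n+1}+(n+1)d\,x^ny\end{pmatrix}.$$ A function $I$ is called an analytic first integral of $\mathbf F$ if it is real-analytic in a neighbourhood of the origin, is not constant in any neighbourhood of the origin, and satisfies $\nabla I\cdot\mathbf F=0$ in a neighbourhood of the origin; $\mathbf F$ is called analytically integrable if it has an analytic first integral. If $\mathbf F$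 is analytically integrable, then $\mathbf F$ has an analytic first integral of the form $$I=I_M+\sum_{j>M}I_j,\qquad I_M=(y-x^{n+1})^{m_1}(y+x^{n+1})^{m_2},\qquad M=(n+1)(m_1+m_2),$$ near the origin, where $I_M$ is quasi-homogeneous of type $\mathbf t$ and degree $M$, and each $I_j$ is a quasi-homogeneous polynomial of type $\mathbf t$ and degree $j$. -/

import Mathlib

open Filter Topology

namespace NilpotentIntegrability

/-- The value at the point `z = (x, y)` of a polynomial in the two variables
`X 0 = x` and `X 1 = y`. -/
noncomputable def evalAt (p : MvPolynomial (Fin 2) ℝ) (z : ℝ × ℝ) : ℝ :=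
  MvPolynomial.eval ![z.1, z.2] p

/-- The scalar polynomial `p` is quasi-homogeneous of type `t = (t₁, t₂)` and degree `k`:
every monomial `x ^ a * y ^ b` of `p` satisfies `t₁ * a + t₂ * b = k`. -/
def IsQuasiHomogeneous (t : ℕ × ℕ) (k : ℕ) (p : MvPolynomial (Fin 2) ℝ) : Prop :=
  MvPolynomial.IsWeightedHomogeneous ![t.1, t.2] p k

/-- The polynomial vector field `G = (G.1, G.2)` is quasi-homogeneous of type `t` and
degree `j`: its components are quasi-homogeneous of degrees `j + t₁` and `j + t₂`. -/
def IsQuasiHomogeneousField (t : ℕ × ℕ) (j : ℕ)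
    (G : MvPolynomial (Fin 2) ℝ × MvPolynomial (Fin 2) ℝ) : Prop :=
  IsQuasiHomogeneous t (j + t.1) G.1 ∧ IsQuasiHomogeneous t (j + t.2) G.2

/-- `f = ∑_{j ≥ k} f_j` near the origin, where `f_j = p j` is quasi-homogeneous of type `t`
and degree `j`. -/
structure IsScalarExpansion (t : ℕ × ℕ) (k : ℕ) (f : ℝ × ℝ → ℝ)
    (p : ℕ → MvPolynomial (Fin 2) ℝ) : Prop where
  quasiHomogeneous : ∀ j, IsQuasiHomogeneous t j (p j)
  eq_zero_of_lt : ∀ j, j < k → p j = 0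
  hasSum : ∀ᶠ z in 𝓝 (0 : ℝ × ℝ), HasSum (fun j => evalAt (p j) z) (f z)

/-- `F = ∑_{j ≥ r} F_j` near the origin, where the vector field `F_j = G j` is
quasi-homogeneous of type `t` and degree `j`. -/
structure IsFieldExpansion (t : ℕ × ℕ) (r : ℕ) (F : ℝ × ℝ → ℝ × ℝ)
    (G : ℕ → MvPolynomial (Fin 2) ℝ × MvPolynomial (Fin 2) ℝ) : Prop where
  quasiHomogeneous : ∀ j, IsQuasiHomogeneousField t j (G j)
  eq_zero_of_lt : ∀ j, j < r → G j = 0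
  hasSum : ∀ᶠ z in 𝓝 (0 : ℝ × ℝ),
    HasSum (fun j => (evalAt (G j).1 z, evalAt (G j).2 z)) (F z)

/-- `I` is an analytic first integral of `F` around the origin: it is analytic at the origin,
it is not locally constant there, and `∇I · F = 0` in a neighbourhood of the origin. -/
structure IsAnalyticFirstIntegral (F : ℝ × ℝ → ℝ × ℝ) (I : ℝ × ℝ → ℝ) : Prop where
  analyticAt : AnalyticAt ℝ I 0
  not_const : ¬ ∀ᶠ z in 𝓝 (0 : ℝ × ℝ), I z = I 0
  derivative_eq_zero : ∀ᶠ z in 𝓝 (0 : ℝ × ℝ), fderiv ℝ I z (F z) = 0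

/-- The vector field `F` is analytically integrable around the origin. -/
def IsAnalyticallyIntegrable (F : ℝ × ℝ → ℝ × ℝ) : Prop :=
  ∃ I : ℝ × ℝ → ℝ, IsAnalyticFirstIntegral F I

/-- The polynomial vector field
`(y + d x ^ (n + 1), (n + 1) x ^ (2 n + 1) + (n + 1) d x ^ n y)`. -/
noncomputable def leadingField (n : ℕ) (d : ℝ) :
    MvPolynomial (Fin 2) ℝ × MvPolynomial (Fin 2) ℝ :=
  (MvPolynomial.X 1 + MvPolynomial.C d * MvPolynomial.X 0 ^ (n + 1),
    MvPolynomial.C ((n : ℝ) + 1) * MvPolynomial.X 0 ^ (2 * n + 1)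
      + MvPolynomial.C (((n : ℝ) + 1) * d) * MvPolynomial.X 0 ^ n * MvPolynomial.X 1)

/-- The polynomial `(y - x ^ (n + 1)) ^ m₁ * (y + x ^ (n + 1)) ^ m₂`. -/
noncomputable def leadingIntegral (n m₁ m₂ : ℕ) : MvPolynomial (Fin 2) ℝ :=
  (MvPolynomial.X 1 - MvPolynomial.X 0 ^ (n + 1)) ^ m₁
    * (MvPolynomial.X 1 + MvPolynomial.X 0 ^ (n + 1)) ^ m₂

end NilpotentIntegrability

namespace NilpotentIntegrability

/-! Put `t = n + 1` and `y = x ^ t * w`. Up to the factor `x ^ n`, the field becomes `p x ∂_x + q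
∂_w` with `p`, `q` power series in `x` over `ℝ[w]`, and a first integral vanishing at the origin
becomes a series `φ` killed by this derivation. The monomial `x ^ a * y ^ b` becomes `x ^ (a + t *
b) * w ^ b`, so the series coming from `(x, y)` are those with `t * deg φ_k ≤ k`, whence the degree
bounds throughout.

Let `P = (w - 1) ^ m₁ * (w + 1) ^ m₂` and `M = t * (m₁ + m₂)`. The lowest coefficient of `φ` lies in
the kernel of `leadingOperator`. This fixes its multiplicities at `1` and `-1`, and coprimality of
`m₁`, `m₂` makes it a multiple of a power of `P` (`exists_leading_form`). Thus `φ = γ x ^ ((s + 1)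
M) e` with `e = P ^ (s + 1) + O(x)`.

It remains to extract an `(s + 1)`-th root `y` of `e`. Solving for its coefficients requires
division by `P ^ s`; this is possible because `e` is killed by the derivation, and an equation `L R
∈ (P ^ s)` at a degree above `s M` forces `R ∈ (P ^ s)` (`basePoly_pow_dvd_of_dvd_leadingOperator`,
`exists_root_of_twistedDeriv_eq_zero`).

The root converges: on the circle `‖w‖ = 2`, where `1 ≤ ‖P‖`, the recursion for `y` gives geometric
bounds, which Cauchy's inequalities transfer to the coefficients in `w`
(`exists_abs_coeff_root_le`). Then `x ^ M * y` is an analytic function `J` of `(x, y)`, the given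
integral is a constant plus `γ J ^ (s + 1)` off `x = 0`, and hence `J` is itself a first integral
(`fderiv_apply_eq_zero_of_pow`). -/

open Polynomial in
/-- The operator `q ↦ k (w + d) q + t (1 - w²) q'` induced on the homogeneous part of degree `k`
by the leading field in the coordinates `(x, w)`, `y = x ^ t * w`. -/
noncomputable def leadingOperator (t d : ℝ) (k : ℕ) (q : ℝ[X]) : ℝ[X] :=
  C (k : ℝ) * (X + C d) * q + C t * (1 - X ^ 2) * derivative q

/-! ### The leading operator on polynomials in `w`: kernel and divisibility. -/

section Polynomials

open Polynomial

/-- Since `1 - w ^ 2` vanishes at `σ`, the operator preserves the order `a` of `q` at `σ` and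
multiplies the leading coefficient there by `k (σ + d) - 2 σ t a`. The order can increase only if
this factor vanishes. -/
theorem mul_eq_of_pow_dvd_leadingOperator {t d σ : ℝ} (hσ : σ ^ 2 = 1) {k : ℕ} {q : ℝ[X]}
    (hq : q ≠ 0) (h : (X - C σ) ^ (q.rootMultiplicity σ + 1) ∣ leadingOperator t d k q) :
    k * (σ + d) = 2 * σ * t * q.rootMultiplicity σ := by
  obtain ⟨g, hg, hgσ⟩ := q.exists_eq_pow_rootMultiplicity_mul_and_not_dvd hq σ
  set a := q.rootMultiplicity σ with ha
  have hroot : g.eval σ ≠ 0 := fun h0 => hgσ (dvd_iff_isRoot.mpr h0)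
  have key : leadingOperator t d k q = (X - C σ) ^ a *
      (C (k : ℝ) * (X + C d) * g - C t * (X + C σ) * (C (a : ℝ) * g + (X - C σ) * derivative g)) := by
    have h1 : (1 - X ^ 2 : ℝ[X]) = - ((X - C σ) * (X + C σ)) := by
      have : C (σ ^ 2) = (1 : ℝ[X]) := by rw [hσ]; simp
      rw [C_pow] at this
      linear_combination -this
    rw [leadingOperator, h1, hg]
    rcases a with _ | a
    · simp; ring
    · rw [derivative_mul, derivative_pow]
      simp
      ring
  rw [key, pow_succ] at h
  have h2 := (mul_dvd_mul_iff_left (pow_ne_zero a (X_sub_C_ne_zero σ))).mp h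
  have h3 := dvd_iff_isRoot.mp h2
  simp only [IsRoot.def, eval_sub, eval_mul, eval_C, eval_add, eval_X, sub_self, zero_mul,
    add_zero] at h3
  have h4 : (k * (σ + d) - 2 * σ * t * a) * g.eval σ = 0 := by linear_combination h3
  have := (mul_eq_zero.mp h4).resolve_right hroot
  linarith

/-- The polynomial `(w - 1) ^ m₁ * (w + 1) ^ m₂`. -/
noncomputable def basePoly (m₁ m₂ : ℕ) : ℝ[X] := (X - C 1) ^ m₁ * (X - C (-1)) ^ m₂

theorem basePoly_monic (m₁ m₂ : ℕ) : (basePoly m₁ m₂).Monic :=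
  ((monic_X_sub_C _).pow _).mul ((monic_X_sub_C _).pow _)

theorem natDegree_basePoly (m₁ m₂ : ℕ) : (basePoly m₁ m₂).natDegree = m₁ + m₂ := by
  rw [basePoly, Monic.natDegree_mul ((monic_X_sub_C _).pow _) ((monic_X_sub_C _).pow _),
    (monic_X_sub_C _).natDegree_pow, (monic_X_sub_C _).natDegree_pow,
    natDegree_X_sub_C, natDegree_X_sub_C, mul_one, mul_one]

theorem basePoly_pow (m₁ m₂ s : ℕ) : basePoly m₁ m₂ ^ s = basePoly (m₁ * s) (m₂ * s) := by
  simp [basePoly, mul_pow, pow_mul]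

theorem basePoly_dvd {a b : ℕ} {q : ℝ[X]} (ha : (X - C (1 : ℝ)) ^ a ∣ q)
    (hb : (X - C (-1 : ℝ)) ^ b ∣ q) : basePoly a b ∣ q :=
  IsCoprime.mul_dvd (IsCoprime.pow (isCoprime_X_sub_C_of_isUnit_sub (by norm_num))) ha hb

theorem mul_eq_of_pow_dvd_leadingOperator_one {m₁ m₂ t k : ℕ} (hm₁ : 1 ≤ m₁) {d : ℝ}
    (hd : d = ((m₁ : ℝ) - (m₂ : ℝ)) / ((m₁ : ℝ) + (m₂ : ℝ))) {q : ℝ[X]} (hq : q ≠ 0)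
    (h : (X - C 1) ^ (q.rootMultiplicity 1 + 1) ∣ leadingOperator t d k q) :
    k * m₁ = t * (m₁ + m₂) * q.rootMultiplicity 1 := by
  have h1 := mul_eq_of_pow_dvd_leadingOperator (by norm_num) hq h
  have : (1 : ℝ) ≤ m₁ := by exact_mod_cast hm₁
  have hpos : ((m₁ : ℝ) + m₂) ≠ 0 := by positivity
  rw [hd] at h1
  field_simp at h1
  have : (k : ℝ) * m₁ = t * (m₁ + m₂) * q.rootMultiplicity 1 := by linarith
  exact_mod_cast this

theorem mul_eq_of_pow_dvd_leadingOperator_neg_one {m₁ m₂ t k : ℕ} (hm₁ : 1 ≤ m₁) {d : ℝ}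
    (hd : d = ((m₁ : ℝ) - (m₂ : ℝ)) / ((m₁ : ℝ) + (m₂ : ℝ))) {q : ℝ[X]} (hq : q ≠ 0)
    (h : (X - C (-1)) ^ (q.rootMultiplicity (-1) + 1) ∣ leadingOperator t d k q) :
    k * m₂ = t * (m₁ + m₂) * q.rootMultiplicity (-1) := by
  have h1 := mul_eq_of_pow_dvd_leadingOperator (by norm_num) hq h
  have : (1 : ℝ) ≤ m₁ := by exact_mod_cast hm₁
  have hpos : ((m₁ : ℝ) + m₂) ≠ 0 := by positivity
  rw [hd] at h1
  field_simp at h1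
  have : (k : ℝ) * m₂ = t * (m₁ + m₂) * q.rootMultiplicity (-1) := by linarith
  exact_mod_cast this

/-- If the order `a` of `q` at `1` were below `m₁ s`, the operator would raise it, so `k m₁ = t (m₁
+ m₂) a < t (m₁ + m₂) m₁ s`, against the lower bound on `k`. The same argument applies at `-1`. -/
theorem basePoly_pow_dvd_of_dvd_leadingOperator {m₁ m₂ t k s : ℕ} (hm₁ : 1 ≤ m₁) (hm₂ : 1 ≤ m₂)
    {d : ℝ} (hd : d = ((m₁ : ℝ) - (m₂ : ℝ)) / ((m₁ : ℝ) + (m₂ : ℝ)))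
    (hk : s * (t * (m₁ + m₂)) < k) {q : ℝ[X]}
    (h : basePoly m₁ m₂ ^ s ∣ leadingOperator t d k q) : basePoly m₁ m₂ ^ s ∣ q := by
  rcases eq_or_ne q 0 with rfl | hq
  · exact dvd_zero _
  rw [basePoly_pow] at h ⊢
  refine basePoly_dvd ?_ ?_
  · rw [← le_rootMultiplicity_iff hq]
    by_contra! hlt
    have h1 := mul_eq_of_pow_dvd_leadingOperator_one hm₁ hd hq
      ((pow_dvd_pow _ hlt).trans ((dvd_mul_right _ _).trans h))
    have h2 : s * (t * (m₁ + m₂)) * m₁ < k * m₁ := Nat.mul_lt_mul_of_pos_right hk hm₁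
    have h3 := Nat.mul_le_mul_left (t * (m₁ + m₂)) hlt.le
    rw [h1] at h2
    nlinarith
  · rw [← le_rootMultiplicity_iff hq]
    by_contra! hlt
    have h1 := mul_eq_of_pow_dvd_leadingOperator_neg_one hm₁ hd hq
      ((pow_dvd_pow _ hlt).trans ((dvd_mul_left _ _).trans h))
    have h2 : s * (t * (m₁ + m₂)) * m₂ < k * m₂ := Nat.mul_lt_mul_of_pos_right hk hm₂
    have h3 := Nat.mul_le_mul_left (t * (m₁ + m₂)) hlt.le
    rw [h1] at h2
    nlinarith

theorem eq_C_mul_basePoly_pow_of_leadingOperator_eq_zero {m₁ m₂ t k : ℕ} (hm₁ : 1 ≤ m₁)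
    (hcop : Nat.Coprime m₁ m₂) (ht : 1 ≤ t) {d : ℝ}
    (hd : d = ((m₁ : ℝ) - (m₂ : ℝ)) / ((m₁ : ℝ) + (m₂ : ℝ))) {q : ℝ[X]} (hq : q ≠ 0)
    (hdeg : t * q.natDegree ≤ k) (h : leadingOperator t d k q = 0) :
    ∃ s : ℕ, ∃ c : ℝ, c ≠ 0 ∧ k = s * (t * (m₁ + m₂)) ∧ q = C c * basePoly m₁ m₂ ^ s := by
  have h1 := mul_eq_of_pow_dvd_leadingOperator_one hm₁ hd hq (h ▸ dvd_zero _)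
  have h2 := mul_eq_of_pow_dvd_leadingOperator_neg_one hm₁ hd hq (h ▸ dvd_zero _)
  set a := q.rootMultiplicity 1 with ha
  set b := q.rootMultiplicity (-1) with hb
  -- Adding the two multiplicity equations shows that the roots `±1` exhaust the degree allowed to
  -- `q`; their ratio then gives `a : b = m₁ : m₂`.
  have hsum : k = t * (a + b) := by
    have : (m₁ + m₂) * k = (m₁ + m₂) * (t * (a + b)) := by linarith
    exact Nat.eq_of_mul_eq_mul_left (by omega) this
  have hab : b * m₁ = a * m₂ := by
    have : t * (m₁ + m₂) * (b * m₁) = t * (m₁ + m₂) * (a * m₂) := by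
      calc _ = k * m₂ * m₁ := by rw [h2]; ring
        _ = k * m₁ * m₂ := by ring
        _ = _ := by rw [h1]; ring
    exact Nat.eq_of_mul_eq_mul_left (by positivity) this
  obtain ⟨s, hs⟩ : m₁ ∣ a := hcop.dvd_of_dvd_mul_right ⟨b, by rw [← hab]; ring⟩
  have hbs : b = m₂ * s := by
    rw [hs] at hab
    exact Nat.eq_of_mul_eq_mul_right hm₁ (by rw [hab]; ring)
  have hdvd : basePoly m₁ m₂ ^ s ∣ q := by
    rw [basePoly_pow, ← hs, ← hbs]
    exact basePoly_dvd (pow_rootMultiplicity_dvd q 1) (pow_rootMultiplicity_dvd q (-1))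
  have hle : q.natDegree ≤ (basePoly m₁ m₂ ^ s).natDegree := by
    rw [basePoly_pow, natDegree_basePoly, ← hs, ← hbs]
    rw [hsum] at hdeg
    exact Nat.le_of_mul_le_mul_left hdeg ht
  refine ⟨s, q.leadingCoeff, leadingCoeff_ne_zero.mpr hq, ?_, ?_⟩
  · rw [hsum, hs, hbs]; ring
  · exact eq_leadingCoeff_mul_of_monic_of_dvd_of_natDegree_le ((basePoly_monic _ _).pow _)
      hdvd hle

end Polynomials

/-! ### Power series over `ℝ[w]`: the derivation, degree bounds and formal roots. -/

section Formal

open PowerSeries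

local notation "𝓢" => PowerSeries (Polynomial ℝ)

/-- The derivative with respect to `w` of a power series in `x` over `ℝ[w]`. -/
noncomputable def wDeriv (φ : 𝓢) : 𝓢 := PowerSeries.mk fun k => (coeff k φ).derivative

@[simp] theorem coeff_wDeriv (k : ℕ) (φ : 𝓢) :
    coeff k (wDeriv φ) = (coeff k φ).derivative := coeff_mk _ _

theorem wDeriv_add (φ ψ : 𝓢) : wDeriv (φ + ψ) = wDeriv φ + wDeriv ψ := by
  ext1 k; simp

theorem wDeriv_mul (φ ψ : 𝓢) : wDeriv (φ * ψ) = φ * wDeriv ψ + ψ * wDeriv φ := by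
  ext1 k
  simp only [coeff_wDeriv, map_add]
  rw [mul_comm ψ, coeff_mul, coeff_mul, coeff_mul, Polynomial.derivative_sum,
    ← Finset.sum_add_distrib]
  refine Finset.sum_congr rfl fun ij _ => ?_
  simp [Polynomial.derivative_mul]
  ring

/-- The operator `φ ↦ p x φ_x + q φ_w + k p φ`; this is the derivation `p x ∂_x + q ∂_w`
conjugated by `x ^ k`. -/
noncomputable def twistedDeriv (p q : 𝓢) (k : ℕ) (φ : 𝓢) : 𝓢 :=
  p * (X * d⁄dX _ φ) + q * wDeriv φ + (k : 𝓢) * p * φ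

variable (p q : PowerSeries (Polynomial ℝ))

theorem twistedDeriv_mul (k l : ℕ) (φ ψ : 𝓢) :
    twistedDeriv p q (k + l) (φ * ψ) = φ * twistedDeriv p q l ψ + ψ * twistedDeriv p q k φ := by
  simp only [twistedDeriv, Derivation.leibniz, wDeriv_mul, smul_eq_mul]
  push_cast
  ring

theorem twistedDeriv_add (k : ℕ) (φ ψ : 𝓢) :
    twistedDeriv p q k (φ + ψ) = twistedDeriv p q k φ + twistedDeriv p q k ψ := by
  simp only [twistedDeriv, wDeriv_add, map_add]
  ring

theorem twistedDeriv_pow (k s : ℕ) (φ : 𝓢) :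
    twistedDeriv p q ((s + 1) * k) (φ ^ (s + 1)) = ((s : 𝓢) + 1) * φ ^ s * twistedDeriv p q k φ := by
  induction s with
  | zero => simp
  | succ s ih =>
    rw [pow_succ, add_mul _ 1, one_mul, twistedDeriv_mul, ih]
    push_cast
    ring

/-- Factoring out `x ^ m` only shifts the twist, so every coefficient of a solution can be studied
as a constant term. -/
theorem twistedDeriv_X_pow_mul (k m : ℕ) (φ : 𝓢) :
    twistedDeriv p q k (X ^ m * φ) = X ^ m * twistedDeriv p q (k + m) φ := by
  induction m generalizing k with
  | zero => simp
  | succ m ih =>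
    have h : twistedDeriv p q k (X * (X ^ m * φ)) = X * twistedDeriv p q (k + 1) (X ^ m * φ) := by
      have hX : wDeriv (X : 𝓢) = 0 := by
        ext1 k; simp [coeff_X]; split_ifs <;> simp
      simp only [twistedDeriv, Derivation.leibniz, wDeriv_mul, smul_eq_mul, hX, derivative_X]
      push_cast
      ring
    rw [pow_succ', mul_assoc, h, ih, mul_assoc, add_assoc, add_comm 1 m]

variable {p q}

theorem constantCoeff_twistedDeriv {t d : ℝ}
    (hp : constantCoeff p = Polynomial.X + Polynomial.C d)
    (hq : constantCoeff q = Polynomial.C t * (1 - Polynomial.X ^ 2)) (k : ℕ) (φ : 𝓢) :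
    constantCoeff (twistedDeriv p q k φ) = leadingOperator t d k (constantCoeff φ) := by
  have h : constantCoeff (wDeriv φ) = (constantCoeff φ).derivative := by
    rw [← coeff_zero_eq_constantCoeff_apply, coeff_wDeriv, coeff_zero_eq_constantCoeff_apply]
  simp [twistedDeriv, leadingOperator, hp, hq, h]
  ring

/-- The condition `t * deg φ_j ≤ K + j` on the coefficients of `φ`. -/
def HasDegreeBound (t K : ℕ) (φ : 𝓢) : Prop := ∀ j, t * (coeff j φ).natDegree ≤ K + j

theorem HasDegreeBound.add {t K : ℕ} {φ ψ : 𝓢} (hφ : HasDegreeBound t K φ)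
    (hψ : HasDegreeBound t K ψ) : HasDegreeBound t K (φ + ψ) := fun j => by
  rw [map_add]
  rcases le_total (coeff j φ).natDegree (coeff j ψ).natDegree with h | h
  · exact (Nat.mul_le_mul_left t (Polynomial.natDegree_add_le_of_degree_le h le_rfl)).trans (hψ j)
  · exact (Nat.mul_le_mul_left t (Polynomial.natDegree_add_le_of_degree_le le_rfl h)).trans (hφ j)

theorem HasDegreeBound.neg {t K : ℕ} {φ : 𝓢} (hφ : HasDegreeBound t K φ) :
    HasDegreeBound t K (-φ) := fun j => by
  rw [map_neg, Polynomial.natDegree_neg]; exact hφ j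

theorem mul_natDegree_sum_le {ι : Type*} (s : Finset ι) (f : ι → Polynomial ℝ) {t K : ℕ}
    (h : ∀ i ∈ s, t * (f i).natDegree ≤ K) : t * (∑ i ∈ s, f i).natDegree ≤ K := by
  rcases Nat.eq_zero_or_pos t with rfl | ht
  · simp
  rw [mul_comm, ← Nat.le_div_iff_mul_le ht]
  refine Polynomial.natDegree_sum_le_of_forall_le s f fun i hi => ?_
  rw [Nat.le_div_iff_mul_le ht, mul_comm]
  exact h i hi

theorem HasDegreeBound.mul {t K L : ℕ} {φ ψ : 𝓢} (hφ : HasDegreeBound t K φ)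
    (hψ : HasDegreeBound t L ψ) : HasDegreeBound t (K + L) (φ * ψ) := fun j => by
  rw [coeff_mul]
  refine mul_natDegree_sum_le _ _ fun ij hij => ?_
  have h1 := hφ ij.1
  have h2 := hψ ij.2
  have h3 := Finset.HasAntidiagonal.mem_antidiagonal.mp hij
  have h4 := Nat.mul_le_mul_left t
    (Polynomial.natDegree_mul_le (p := coeff ij.1 φ) (q := coeff ij.2 ψ))
  rw [mul_add] at h4
  omega

theorem HasDegreeBound.pow {t K : ℕ} {φ : 𝓢} (hφ : HasDegreeBound t K φ) (s : ℕ) :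
    HasDegreeBound t (s * K) (φ ^ s) := by
  induction s with
  | zero => intro j; simp [coeff_one]; split_ifs <;> simp
  | succ s ih => rw [pow_succ, add_mul, one_mul]; exact ih.mul hφ

theorem eq_of_forall_X_pow_dvd_sub {R : Type*} [CommRing R] {φ ψ : PowerSeries R}
    (h : ∀ N : ℕ, (X : PowerSeries R) ^ (N + 1) ∣ φ - ψ) : φ = ψ := by
  ext N
  have := X_pow_dvd_iff.mp (h N) N (Nat.lt_succ_self N)
  rwa [map_sub, sub_eq_zero] at this

/-- A power series has an `s`-th root with prescribed constant term as soon as every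
approximate root within a class `A` can be improved within `A`. -/
theorem exists_pow_eq_of_step {R : Type*} [CommRing R] (A : PowerSeries R → Prop) (s : ℕ)
    (e φ₀ : PowerSeries R) (h₀ : A φ₀) (h₀e : X ∣ e - φ₀ ^ s)
    (step : ∀ (N : ℕ) (φ : PowerSeries R), A φ → X ∣ φ - φ₀ → X ^ (N + 1) ∣ e - φ ^ s →
      ∃ r : R, A (φ + X ^ (N + 1) * C r) ∧ X ^ (N + 2) ∣ e - (φ + X ^ (N + 1) * C r) ^ s) :
    ∃ y : PowerSeries R, y ^ s = e ∧
      ∀ N, ∃ φ, A φ ∧ X ∣ φ - φ₀ ∧ X ^ (N + 1) ∣ y - φ := by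
  classical
  choose! r hrA hr using step
  let φ : ℕ → PowerSeries R := fun N =>
    Nat.rec φ₀ (fun N φ => φ + X ^ (N + 1) * C (r N φ)) N
  have hsucc : ∀ N, φ (N + 1) = φ N + X ^ (N + 1) * C (r N (φ N)) := fun N => rfl
  have hφ : ∀ N, A (φ N) ∧ X ∣ φ N - φ₀ ∧ X ^ (N + 1) ∣ e - φ N ^ s := by
    intro N
    induction N with
    | zero => exact ⟨h₀, by simp [φ], by simpa [φ] using h₀e⟩
    | succ N ih =>
      obtain ⟨h1, h2, h3⟩ := ih
      refine ⟨?_, ?_, ?_⟩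
      · rw [hsucc]; exact hrA N _ h1 h2 h3
      · rw [hsucc, add_sub_right_comm]
        exact dvd_add h2 (Dvd.dvd.mul_right (dvd_pow_self _ N.succ_ne_zero) _)
      · rw [hsucc]; exact hr N _ h1 h2 h3
  have hstab : ∀ N k, X ^ (N + 1) ∣ φ (N + k) - φ N := by
    intro N k
    induction k with
    | zero => simp
    | succ k ih =>
      rw [← add_assoc, hsucc, add_sub_right_comm]
      exact dvd_add ih (Dvd.dvd.mul_right (pow_dvd_pow _ (by omega)) _)
  -- The coefficient of index `N` no longer changes after stage `N`, so the diagonal is the `X`-adic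
  -- limit.
  let y : PowerSeries R := PowerSeries.mk fun N => coeff N (φ N)
  have hy : ∀ N, X ^ (N + 1) ∣ y - φ N := by
    intro N
    rw [X_pow_dvd_iff]
    intro m hm
    obtain ⟨k, rfl⟩ := Nat.exists_eq_add_of_le (Nat.lt_succ_iff.mp hm)
    have := X_pow_dvd_iff.mp (hstab m k) m (Nat.lt_succ_self m)
    rw [map_sub, sub_eq_zero] at this ⊢
    rw [this, coeff_mk]
  refine ⟨y, eq_of_forall_X_pow_dvd_sub fun N => ?_, fun N => ⟨φ N, (hφ N).1, (hφ N).2.1, hy N⟩⟩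
  have h1 := (hy N).trans (sub_dvd_pow_sub_pow y (φ N) s)
  have := dvd_sub h1 (hφ N).2.2
  rwa [sub_sub_sub_cancel_right] at this

/-- First-order Taylor expansion: the remainder is divisible by the square of the increment, and `2
(N + 1) ≥ N + 2`. -/
theorem X_sq_dvd_add_pow_sub {R : Type*} [CommRing R] (s N : ℕ) (φ : PowerSeries R) (r : R) :
    (X : PowerSeries R) ^ (N + 2) ∣
      (φ + X ^ (N + 1) * C r) ^ (s + 1) - φ ^ (s + 1)
        - ((s : PowerSeries R) + 1) * φ ^ s * (X ^ (N + 1) * C r) := by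
  set ε : PowerSeries R := X ^ (N + 1) * C r with hε
  have h1 : ε ^ 2 ∣ (φ + ε) ^ (s + 1) - φ ^ (s + 1) - ((s : PowerSeries R) + 1) * φ ^ s * ε := by
    have h := (Polynomial.binomExpansion (Polynomial.X ^ (s + 1) : Polynomial (PowerSeries R)) φ ε)
    obtain ⟨c, hc⟩ := h
    refine ⟨c, ?_⟩
    simp at hc
    rw [hc]; ring
  refine dvd_trans ?_ h1
  rw [hε, mul_pow, ← pow_mul]
  exact Dvd.dvd.mul_right (pow_dvd_pow _ (by omega)) _

/-- The root is built term by term. If `e - φ ^ (s + 1) = x ^ (N + 1) ρ`, the next correction is `ρ₀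
/ ((s + 1) P ^ s)`; the equation satisfied by `e` makes this quotient a polynomial. -/
theorem exists_root_of_twistedDeriv_eq_zero {m₁ m₂ t s : ℕ} (hm₁ : 1 ≤ m₁) (hm₂ : 1 ≤ m₂)
    {d : ℝ} (hd : d = ((m₁ : ℝ) - (m₂ : ℝ)) / ((m₁ : ℝ) + (m₂ : ℝ)))
    (hp : constantCoeff p = Polynomial.X + Polynomial.C d)
    (hq : constantCoeff q = Polynomial.C (t : ℝ) * (1 - Polynomial.X ^ 2))
    {e : 𝓢} (he : HasDegreeBound t ((s + 1) * (t * (m₁ + m₂))) e)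
    (he₀ : constantCoeff e = basePoly m₁ m₂ ^ (s + 1))
    (hDe : twistedDeriv p q ((s + 1) * (t * (m₁ + m₂))) e = 0) :
    ∃ y : 𝓢, y ^ (s + 1) = e ∧ HasDegreeBound t (t * (m₁ + m₂)) y ∧
      constantCoeff y = basePoly m₁ m₂ := by
  set M := t * (m₁ + m₂) with hM
  set P := basePoly m₁ m₂ with hP
  have hPmonic : P.Monic := basePoly_monic m₁ m₂
  have hconst : ∀ φ : 𝓢, X ∣ φ - C P → constantCoeff φ = P := fun φ h => by
    have := X_dvd_iff.mp h
    rw [map_sub, sub_eq_zero] at this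
    simpa using this
  have key : ∃ y : 𝓢, y ^ (s + 1) = e ∧
      ∀ N, ∃ φ, HasDegreeBound t M φ ∧ X ∣ φ - C P ∧ X ^ (N + 1) ∣ y - φ := by
    refine exists_pow_eq_of_step (HasDegreeBound t M) (s + 1) e (C P) ?_ ?_ ?_
    · intro j
      rcases eq_or_ne j 0 with rfl | hj
      · simp [hP, natDegree_basePoly, hM]
      · simp [coeff_C, hj]
    · rw [X_dvd_iff]; simp [he₀]
    · intro N φ hφ hφ₀ hdvd
      have hφP := hconst φ hφ₀
      have hφne : ¬ (X : 𝓢) ∣ φ ^ s := by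
        rw [X_dvd_iff, map_pow, hφP]; exact (hPmonic.pow s).ne_zero
      obtain ⟨ρ, hρ⟩ := hdvd
      set R := constantCoeff ρ with hR
      -- Apply the derivation to `e - φ ^ (s + 1)`: it kills `e`, and the chain rule puts a factor
      -- `φ ^ s` on the right.
      have hD : X ^ (N + 1) * twistedDeriv p q ((s + 1) * M + (N + 1)) ρ
          = - (((s : 𝓢) + 1) * φ ^ s * twistedDeriv p q M φ) := by
        rw [← twistedDeriv_X_pow_mul, ← twistedDeriv_pow, ← hρ, eq_neg_iff_add_eq_zero,
          ← twistedDeriv_add, sub_add_cancel, hDe]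
      have hs0 : (((s : ℝ) + 1)) ≠ 0 := by positivity
      have hcast : ((s : 𝓢) + 1) = C (Polynomial.C ((s : ℝ) + 1)) := by simp
      have hunit : C (Polynomial.C ((s : ℝ) + 1)⁻¹) * ((s : 𝓢) + 1) = 1 := by
        rw [hcast, ← map_mul, ← map_mul, inv_mul_cancel₀ hs0]; simp
      have hdvd2 : (X : 𝓢) ^ (N + 1) ∣ φ ^ s * twistedDeriv p q M φ := by
        refine ⟨- (C (Polynomial.C ((s : ℝ) + 1)⁻¹)
          * twistedDeriv p q ((s + 1) * M + (N + 1)) ρ), ?_⟩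
        linear_combination (- (φ ^ s * twistedDeriv p q M φ)) * hunit
          + C (Polynomial.C ((s : ℝ) + 1)⁻¹) * hD
      -- `φ ^ s` has constant term `P ^ s ≠ 0`, so the whole power of the prime `X` divides the
      -- other factor. Cancelling it and taking constant terms gives `L R ∈ (P ^ s)`.
      obtain ⟨ψ, hψ⟩ := X_prime.pow_dvd_of_dvd_mul_left _ hφne hdvd2
      have hL : leadingOperator t d ((s + 1) * M + (N + 1)) R
          = P ^ s * (- (Polynomial.C ((s : ℝ) + 1)) * constantCoeff ψ) := by
        rw [hR, ← constantCoeff_twistedDeriv hp hq]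
        have : twistedDeriv p q ((s + 1) * M + (N + 1)) ρ = - (((s : 𝓢) + 1) * φ ^ s * ψ) := by
          refine mul_left_cancel₀ (pow_ne_zero (N + 1) (X_ne_zero (R := Polynomial ℝ))) ?_
          rw [hD, hψ]; ring
        rw [this]
        simp [hφP]
        ring
      have hRdvd : P ^ s ∣ R :=
        basePoly_pow_dvd_of_dvd_leadingOperator hm₁ hm₂ hd
          (by rw [← hM, add_mul]; omega) ⟨_, hL⟩
      obtain ⟨R', hR'⟩ := hRdvd
      have hdegR : t * R.natDegree ≤ (s + 1) * M + (N + 1) := by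
        have h1 := (he.add (hφ.pow (s + 1)).neg) (N + 1)
        rw [← sub_eq_add_neg, hρ, coeff_X_pow_mul'] at h1
        simpa using h1
      refine ⟨Polynomial.C ((s : ℝ) + 1)⁻¹ * R', hφ.add ?_, ?_⟩
      · intro j
        rw [coeff_X_pow_mul', coeff_C]
        split_ifs with h1 h2
        -- Dividing `R` by `P ^ s` lowers `t * deg` by exactly `s M`, so the bound `(s + 1) M + N +
        -- 1` becomes `M + N + 1`.
        · have hj : j = N + 1 := by omega
          rw [Polynomial.natDegree_C_mul (inv_ne_zero hs0), hj]
          rcases eq_or_ne R' 0 with h0 | h0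
          · simp [h0]
          · rw [hR', (hPmonic.pow s).natDegree_mul' h0, hPmonic.natDegree_pow, hP,
              natDegree_basePoly, mul_add, add_mul, one_mul] at hdegR
            have : t * (s * (m₁ + m₂)) = s * M := by rw [hM]; ring
            omega
        · simp
        · simp
      · have h1 := X_sq_dvd_add_pow_sub s N φ (Polynomial.C ((s : ℝ) + 1)⁻¹ * R')
        have h2 : (X : 𝓢) ^ (N + 2) ∣ e - φ ^ (s + 1) - ((s : 𝓢) + 1) * φ ^ s *
            (X ^ (N + 1) * C (Polynomial.C ((s : ℝ) + 1)⁻¹ * R')) := by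
          have h3 : X ∣ ρ - φ ^ s * C R' := by
            rw [X_dvd_iff]; simp [hφP, ← hR, hR']
          obtain ⟨η, hη⟩ := h3
          refine ⟨η, ?_⟩
          rw [hρ, map_mul]
          linear_combination X ^ (N + 1) * hη - (φ ^ s * X ^ (N + 1) * C R') * hunit
        have := dvd_sub h2 h1
        convert this using 1
        ring
  obtain ⟨y, hy, happ⟩ := key
  refine ⟨y, hy, fun j => ?_, ?_⟩
  · obtain ⟨φ, h1, -, h3⟩ := happ j
    have := X_pow_dvd_iff.mp h3 j (Nat.lt_succ_self j)
    rw [map_sub, sub_eq_zero] at this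
    rw [this]; exact h1 j
  · obtain ⟨φ, -, h2, h3⟩ := happ 0
    have := X_dvd_iff.mp (by simpa using h3)
    rw [map_sub, sub_eq_zero] at this
    rw [this, hconst φ h2]

end Formal

/-! ### Convergent double power series: analyticity and Euler derivatives. -/

section DoubleSeries

/-- The coefficients `c` of a double power series grow at most geometrically. -/
def GeometricBound (c : ℕ → ℕ → ℝ) : Prop :=
  ∃ C B : ℝ, 0 ≤ C ∧ 1 ≤ B ∧ ∀ a b, |c a b| ≤ C * B ^ (a + b)

/-- The terms of the double power series with coefficients `c`. -/
def doubleTerm (c : ℕ → ℕ → ℝ) (z : ℝ × ℝ) (ab : ℕ × ℕ) : ℝ :=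
  c ab.1 ab.2 * (z.1 ^ ab.1 * z.2 ^ ab.2)

/-- The sum of the double power series with coefficients `c`. -/
noncomputable def doubleSum (c : ℕ → ℕ → ℝ) (z : ℝ × ℝ) : ℝ := ∑' ab, doubleTerm c z ab

theorem summable_pow_mul_pow {r : ℝ} (h0 : 0 ≤ r) (h1 : r < 1) :
    Summable fun ab : ℕ × ℕ => r ^ ab.1 * r ^ ab.2 :=
  (summable_geometric_of_lt_one h0 h1).mul_of_nonneg (summable_geometric_of_lt_one h0 h1)
    (fun _ => pow_nonneg h0 _) (fun _ => pow_nonneg h0 _)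

theorem abs_doubleTerm_le {c : ℕ → ℕ → ℝ} {C B ρ : ℝ} (hC : 0 ≤ C) (hB : 0 ≤ B)
    (hc : ∀ a b, |c a b| ≤ C * B ^ (a + b)) {z : ℝ × ℝ} (h1 : |z.1| ≤ ρ) (h2 : |z.2| ≤ ρ)
    (ab : ℕ × ℕ) : |doubleTerm c z ab| ≤ C * ((B * ρ) ^ ab.1 * (B * ρ) ^ ab.2) := by
  have hρ : 0 ≤ ρ := (abs_nonneg _).trans h1
  rw [doubleTerm, abs_mul, abs_mul, abs_pow, abs_pow]
  calc |c ab.1 ab.2| * (|z.1| ^ ab.1 * |z.2| ^ ab.2)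
      ≤ (C * B ^ (ab.1 + ab.2)) * (ρ ^ ab.1 * ρ ^ ab.2) := by
        gcongr
        exact hc _ _
    _ = _ := by rw [mul_pow, mul_pow, pow_add]; ring

theorem eventually_abs_lt {ρ : ℝ} (hρ : 0 < ρ) :
    ∀ᶠ z in 𝓝 (0 : ℝ × ℝ), |z.1| < ρ ∧ |z.2| < ρ := by
  filter_upwards [Metric.ball_mem_nhds (0 : ℝ × ℝ) hρ] with z hz
  rw [mem_ball_zero_iff] at hz
  exact ⟨(norm_fst_le z).trans_lt hz, (norm_snd_le z).trans_lt hz⟩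

theorem GeometricBound.eventually_summable {c : ℕ → ℕ → ℝ} (hc : GeometricBound c) :
    ∀ᶠ z in 𝓝 (0 : ℝ × ℝ), Summable (doubleTerm c z) := by
  obtain ⟨C, B, hC, hB, hc⟩ := hc
  have hB0 : 0 < B := by linarith
  filter_upwards [eventually_abs_lt (ρ := 1 / (2 * B)) (by positivity)] with z hz
  refine Summable.of_norm_bounded (g := fun ab : ℕ × ℕ => C * ((1 / 2) ^ ab.1 * (1 / 2) ^ ab.2))
    ((summable_pow_mul_pow (by norm_num) (by norm_num)).mul_left C) fun ab => ?_
  have := abs_doubleTerm_le hC hB0.le hc hz.1.le hz.2.le ab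
  rwa [show B * (1 / (2 * B)) = 1 / 2 by field_simp] at this

/-- Regrouping by weight `a + t * b`: `t = 1` gives the usual homogeneous expansion, `t = n + 1` the
quasi-homogeneous one. -/
theorem hasSum_group {f : ℕ × ℕ → ℝ} (hf : Summable f) {t : ℕ} (ht : 1 ≤ t) :
    HasSum (fun k => ∑ b ∈ (Finset.range (k + 1)).filter (fun b => t * b ≤ k), f (k - t * b, b))
      (∑' ab, f ab) := by
  have h := hf.hasSum.tsum_fiberwise (fun ab : ℕ × ℕ => ab.1 + t * ab.2)
  suffices key : ∀ k, ∑' ab : ((fun ab : ℕ × ℕ => ab.1 + t * ab.2) ⁻¹' {k} : Set (ℕ × ℕ)), f ab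
      = ∑ b ∈ (Finset.range (k + 1)).filter (fun b => t * b ≤ k), f (k - t * b, b) by
    rw [funext key] at h
    exact h
  intro k
  have hset : (fun ab : ℕ × ℕ => ab.1 + t * ab.2) ⁻¹' {k} =
      ↑(((Finset.range (k + 1)).filter (fun b => t * b ≤ k)).image fun b => (k - t * b, b)) := by
    ext ⟨a, b⟩
    simp only [Set.mem_preimage, Set.mem_singleton_iff, Finset.coe_image, Finset.coe_filter,
      Finset.mem_range, Set.mem_image, Set.mem_ofPred_eq, Prod.mk.injEq]
    constructor
    · intro h
      have : b ≤ t * b := Nat.le_mul_of_pos_left b ht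
      exact ⟨b, ⟨by omega, by omega⟩, by omega, rfl⟩
    · rintro ⟨b', ⟨-, h1⟩, h2, rfl⟩
      omega
  rw [hset, Finset.tsum_subtype', Finset.sum_image]
  intro b _ b' _ h
  exact (Prod.mk.inj h).2

theorem filter_one_mul_le (k : ℕ) :
    (Finset.range (k + 1)).filter (fun b => 1 * b ≤ k) = Finset.range (k + 1) := by
  ext b; simp

/-- Expand the `k`-linear terms on the standard basis: the coefficient of `x ^ a * y ^ b` sums over
the sets of `a` slots receiving `(1, 0)`. There are at most `2 ^ (a + b)` such sets, so the bound
stays geometric. -/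
theorem exists_hasSum_of_analyticAt {g : ℝ × ℝ → ℝ} (hg : AnalyticAt ℝ g 0) :
    ∃ c, GeometricBound c ∧ ∀ᶠ z in 𝓝 (0 : ℝ × ℝ), g z = doubleSum c z := by
  obtain ⟨p, r, hp⟩ := hg
  let e : ∀ {k : ℕ}, Finset (Fin k) → Fin k → ℝ × ℝ := fun s =>
    s.piecewise (fun _ => ((1 : ℝ), (0 : ℝ))) (fun _ => ((0 : ℝ), (1 : ℝ)))
  let c : ℕ → ℕ → ℝ := fun a b =>
    ∑ s ∈ Finset.powersetCard a (Finset.univ : Finset (Fin (a + b))), p (a + b) (e s)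
  have hnorm : ∀ {k : ℕ} (s : Finset (Fin k)), |p k (e s)| ≤ ‖p k‖ := fun {k} s => by
    have := (p k).le_opNorm (e s)
    rw [Real.norm_eq_abs] at this
    refine this.trans (mul_le_of_le_one_right (norm_nonneg _) ?_)
    refine Finset.prod_le_one (fun _ _ => norm_nonneg _) fun i _ => ?_
    by_cases hi : i ∈ s <;> simp [e, hi, Prod.norm_def]
  have hc : GeometricBound c := by
    obtain ⟨ρ, hρ0, hρ⟩ := ENNReal.lt_iff_exists_nnreal_btwn.mp hp.r_pos
    have hρ0' : 0 < (ρ : ℝ) := by exact_mod_cast hρ0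
    obtain ⟨C, hC, hb⟩ := p.norm_mul_pow_le_of_lt_radius (hρ.trans_le hp.r_le)
    refine ⟨C, max 1 (2 / ρ), hC.le, le_max_left _ _, fun a b => ?_⟩
    calc |c a b| ≤ ∑ s ∈ Finset.powersetCard a (Finset.univ : Finset (Fin (a + b))),
          |p (a + b) (e s)| := Finset.abs_sum_le_sum_abs _ _
      _ ≤ ∑ s ∈ (Finset.univ : Finset (Finset (Fin (a + b)))), ‖p (a + b)‖ :=
          (Finset.sum_le_sum fun s _ => hnorm s).trans
            (Finset.sum_le_sum_of_subset_of_nonneg (Finset.subset_univ _)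
              fun _ _ _ => norm_nonneg _)
      _ = 2 ^ (a + b) * ‖p (a + b)‖ := by simp
      _ ≤ 2 ^ (a + b) * (C / ρ ^ (a + b)) := by
          gcongr
          rw [le_div_iff₀ (by positivity)]
          exact hb _
      _ = C * (2 / ρ) ^ (a + b) := by rw [div_pow]; ring
      _ ≤ C * (max 1 (2 / ρ)) ^ (a + b) := by
          gcongr
          exact le_max_right _ _
  refine ⟨c, hc, ?_⟩
  filter_upwards [hc.eventually_summable, Metric.eball_mem_nhds (0 : ℝ × ℝ) hp.r_pos] with z hz hzr
  have h1 := hp.hasSum hzr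
  rw [zero_add] at h1
  have h2 := hasSum_group hz le_rfl
  suffices key : ∀ k, p k (fun _ => z) = ∑ b ∈ (Finset.range (k + 1)).filter (fun b => 1 * b ≤ k),
      doubleTerm c z (k - 1 * b, b) by
    rw [funext key] at h1
    exact h1.unique h2
  intro k
  rw [filter_one_mul_le]
  have hsplit : (fun _ : Fin k => z)
      = (fun _ => z.1 • ((1 : ℝ), (0 : ℝ))) + (fun _ => z.2 • ((0 : ℝ), (1 : ℝ))) := by
    ext <;> simp
  have hpiece : ∀ s : Finset (Fin k), p k (s.piecewise (fun _ => z.1 • ((1 : ℝ), (0 : ℝ)))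
      (fun _ => z.2 • ((0 : ℝ), (1 : ℝ)))) = z.1 ^ s.card * z.2 ^ (k - s.card) * p k (e s) := by
    intro s
    have : s.piecewise (fun _ => z.1 • ((1 : ℝ), (0 : ℝ))) (fun _ => z.2 • ((0 : ℝ), (1 : ℝ)))
        = fun i => (if i ∈ s then z.1 else z.2) • e s i := by
      funext i
      by_cases hi : i ∈ s <;> simp [e, hi]
    rw [this, (p k).map_smul_univ, Finset.prod_ite]
    simp [Finset.filter_not, Finset.card_sdiff]
  rw [hsplit, (p k).map_add_univ, ← Finset.powerset_univ, Finset.sum_powerset, Finset.card_univ,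
    Fintype.card_fin, ← Finset.sum_range_reflect]
  refine Finset.sum_congr rfl fun b hb => ?_
  have hb' : b ≤ k := by simpa [Nat.lt_succ_iff] using hb
  obtain ⟨a, rfl⟩ := Nat.exists_eq_add_of_le' hb'
  have e1 : a + b + 1 - 1 - b = a := by omega
  have e2 : a + b - 1 * b = a := by omega
  rw [e1, e2, doubleTerm, Finset.sum_mul]
  refine Finset.sum_congr rfl fun s hs => ?_
  rw [hpiece, (Finset.mem_powersetCard.mp hs).2, Nat.add_sub_cancel_left, mul_comm]

theorem GeometricBound.analyticAt {c : ℕ → ℕ → ℝ} (hc : GeometricBound c) :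
    AnalyticAt ℝ (doubleSum c) 0 := by
  have hsum := hc.eventually_summable
  obtain ⟨C, B, hC, hB, hc⟩ := hc
  have hB0 : 0 < B := by linarith
  let L : ∀ k b : ℕ, ContinuousMultilinearMap ℝ (fun _ : Fin k => ℝ × ℝ) ℝ := fun k b =>
    (ContinuousMultilinearMap.mkPiAlgebra ℝ (Fin k) ℝ).compContinuousLinearMap
      (fun i => if i.1 < k - b then ContinuousLinearMap.fst ℝ ℝ ℝ
        else ContinuousLinearMap.snd ℝ ℝ ℝ)
  have hL : ∀ k b, ‖L k b‖ ≤ 1 := fun k b => by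
    refine (ContinuousMultilinearMap.norm_compContinuousLinearMap_le _ _).trans ?_
    rw [ContinuousMultilinearMap.norm_mkPiAlgebra, one_mul]
    refine Finset.prod_le_one (fun _ _ => norm_nonneg _) fun i _ => ?_
    split_ifs
    · exact ContinuousLinearMap.norm_fst_le _ _ _
    · exact ContinuousLinearMap.norm_snd_le _ _ _
  have hLz : ∀ a b (z : ℝ × ℝ), L (a + b) b (fun _ => z) = z.1 ^ a * z.2 ^ b := fun a b z => by
    have : L (a + b) b (fun _ => z) = ∏ i : Fin (a + b), (if i.1 < a then z.1 else z.2) := by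
      simp only [L, ContinuousMultilinearMap.compContinuousLinearMap_apply,
        ContinuousMultilinearMap.mkPiAlgebra_apply, Nat.add_sub_cancel]
      refine Finset.prod_congr rfl fun i _ => ?_
      split_ifs <;> rfl
    rw [this, Fin.prod_univ_eq_prod_range (fun i => if i < a then z.1 else z.2),
      Finset.prod_range_add]
    congr 1
    · rw [Finset.prod_congr rfl (g := fun _ => z.1)]
      · simp
      · intro i hi
        rw [if_pos (Finset.mem_range.mp hi)]
    · simp
  let q : FormalMultilinearSeries ℝ (ℝ × ℝ) ℝ := fun k =>
    ∑ b ∈ Finset.range (k + 1), c (k - b) b • L k b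
  have hq : ∀ k, ‖q k‖ ≤ C * (2 * B) ^ k := fun k => by
    calc ‖q k‖ ≤ ∑ b ∈ Finset.range (k + 1), C * B ^ k := by
          refine norm_sum_le_of_le _ fun b hb => ?_
          rw [norm_smul, Real.norm_eq_abs]
          have h1 := hc (k - b) b
          have hb' : b ≤ k := by simpa [Nat.lt_succ_iff] using hb
          rw [Nat.sub_add_cancel hb'] at h1
          exact (mul_le_of_le_one_right (abs_nonneg _) (hL k b)).trans h1
      _ = (k + 1 : ℕ) * (C * B ^ k) := by simp
      _ ≤ (2 ^ k : ℕ) * (C * B ^ k) := by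
          gcongr
          exact Nat.lt_two_pow_self
      _ = C * (2 * B) ^ k := by push_cast; rw [mul_pow]; ring
  have hrad : 0 < q.radius := by
    have hr : (0 : ℝ) < 1 / (2 * B) := by positivity
    refine lt_of_lt_of_le ?_ (q.le_radius_of_bound C (r := ⟨1 / (2 * B), hr.le⟩) fun k => ?_)
    · exact ENNReal.coe_pos.mpr hr
    · change ‖q k‖ * (1 / (2 * B)) ^ k ≤ C
      calc _ ≤ C * (2 * B) ^ k * (1 / (2 * B)) ^ k := by gcongr; exact hq k
        _ = C := by
          rw [mul_assoc, ← mul_pow, mul_one_div_cancel (by positivity), one_pow, mul_one]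
  refine (q.hasFPowerSeriesOnBall hrad).analyticAt.congr ?_
  filter_upwards [hsum] with z hz
  have h2 := hasSum_group hz le_rfl
  rw [FormalMultilinearSeries.sum, doubleSum, ← h2.tsum_eq]
  refine tsum_congr fun k => ?_
  rw [filter_one_mul_le]
  simp only [q, sum_apply, smul_apply]
  refine Finset.sum_congr rfl fun b hb => ?_
  have hb' : b ≤ k := by simpa [Nat.lt_succ_iff] using hb
  obtain ⟨a, rfl⟩ := Nat.exists_eq_add_of_le' hb'
  rw [hLz, one_mul, Nat.add_sub_cancel, doubleTerm, smul_eq_mul]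

theorem GeometricBound.euler_left {c : ℕ → ℕ → ℝ} (hc : GeometricBound c) :
    GeometricBound fun a b => a * c a b := by
  obtain ⟨C, B, hC, hB, hc⟩ := hc
  refine ⟨C, 2 * B, hC, by linarith, fun a b => ?_⟩
  rw [abs_mul, Nat.abs_cast, mul_pow]
  calc (a : ℝ) * |c a b| ≤ 2 ^ (a + b) * (C * B ^ (a + b)) := by
        gcongr
        · have : a ≤ 2 ^ (a + b) := (Nat.le_add_right a b).trans Nat.lt_two_pow_self.le
          exact_mod_cast this
        · exact hc a b
    _ = _ := by ring

theorem GeometricBound.swap {c : ℕ → ℕ → ℝ} (hc : GeometricBound c) :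
    GeometricBound fun a b => c b a := by
  obtain ⟨C, B, hC, hB, hc⟩ := hc
  exact ⟨C, B, hC, hB, fun a b => by rw [add_comm]; exact hc b a⟩

theorem doubleSum_swap (c : ℕ → ℕ → ℝ) (z : ℝ × ℝ) :
    doubleSum (fun a b => c b a) z.swap = doubleSum c z := by
  rw [doubleSum, doubleSum, ← (Equiv.prodComm ℕ ℕ).tsum_eq]
  refine tsum_congr fun ab => ?_
  simp [doubleTerm, mul_comm]

/-- Termwise differentiation. The form `x ∂_x` is used because it acts diagonally on the
coefficients. -/
theorem GeometricBound.hasDerivAt {c : ℕ → ℕ → ℝ} (hc : GeometricBound c) :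
    ∀ᶠ z in 𝓝 (0 : ℝ × ℝ), ∃ D : ℝ, HasDerivAt (fun x => doubleSum c (x, z.2)) D z.1 ∧
      z.1 * D = doubleSum (fun a b => a * c a b) z := by
  have hsum := hc.eventually_summable
  obtain ⟨C, B, hC, hB, hc⟩ := hc
  have hB0 : 0 < B := by linarith
  -- With `B ρ = 1 / 4`, the factor `a ≤ 2 ^ a` produced by differentiation still leaves ratio `1 /
  -- 2`.
  set ρ := 1 / (4 * B) with hρ
  have hρ0 : 0 < ρ := by positivity
  have hBρ : B * ρ = 1 / 4 := by rw [hρ]; field_simp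
  filter_upwards [eventually_abs_lt hρ0, hsum] with z hz hzs
  refine ⟨∑' ab : ℕ × ℕ, c ab.1 ab.2 * ((ab.1 * z.1 ^ (ab.1 - 1)) * z.2 ^ ab.2), ?_, ?_⟩
  · refine hasDerivAt_tsum_of_isPreconnected
      (u := fun ab : ℕ × ℕ => C / ρ * ((1 / 2) ^ ab.1 * (1 / 2) ^ ab.2))
      (g := fun ab x => doubleTerm c (x, z.2) ab)
      (g' := fun ab x => c ab.1 ab.2 * ((ab.1 * x ^ (ab.1 - 1)) * z.2 ^ ab.2))
      (t := Metric.ball 0 ρ) (y₀ := z.1)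
      ((summable_pow_mul_pow (by norm_num) (by norm_num)).mul_left _)
      Metric.isOpen_ball (convex_ball _ _).isPreconnected ?_ ?_ ?_ hzs ?_
    · intro ab x _
      have h := ((hasDerivAt_pow ab.1 x).mul_const (z.2 ^ ab.2)).const_mul (c ab.1 ab.2)
      exact h
    · rintro ⟨a, b⟩ x hx
      rw [mem_ball_zero_iff, Real.norm_eq_abs] at hx
      rcases a with _ | a
      · simp; positivity
      · simp only [norm_mul, norm_pow, Real.norm_eq_abs, Nat.abs_cast, Nat.add_sub_cancel]
        calc |c (a + 1) b| * (((a + 1 : ℕ) : ℝ) * |x| ^ a * |z.2| ^ b)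
            ≤ C * B ^ (a + 1 + b) * ((2 ^ (a + 1) : ℕ) * ρ ^ a * ρ ^ b) := by
              gcongr
              · exact hc _ _
              · exact Nat.lt_two_pow_self.le
              · exact hz.2.le
          _ = C / ρ * ((2 * (B * ρ)) ^ (a + 1) * (B * ρ) ^ b) := by
              push_cast
              rw [mul_pow, mul_pow, mul_pow]
              field_simp
              ring
          _ ≤ C / ρ * ((1 / 2) ^ (a + 1) * (1 / 2) ^ b) := by
              rw [hBρ]
              have : (1 / 4 : ℝ) ^ b ≤ (1 / 2) ^ b :=
                pow_le_pow_left₀ (by norm_num) (by norm_num) b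
              norm_num at this ⊢
              gcongr
    · rw [mem_ball_zero_iff, Real.norm_eq_abs]; exact hz.1
    · rw [mem_ball_zero_iff, Real.norm_eq_abs]; exact hz.1
  · rw [← tsum_mul_left, doubleSum]
    refine tsum_congr fun ab => ?_
    rcases ab with ⟨_ | a, b⟩
    · simp [doubleTerm]
    · simp [doubleTerm, pow_succ]; ring

theorem GeometricBound.fderiv_fst {c : ℕ → ℕ → ℝ} (hc : GeometricBound c) :
    ∀ᶠ z in 𝓝 (0 : ℝ × ℝ), z.1 * fderiv ℝ (doubleSum c) z (1, 0)
      = doubleSum (fun a b => a * c a b) z := by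
  filter_upwards [hc.hasDerivAt, hc.analyticAt.eventually_analyticAt] with z ⟨D, hD, hz⟩ han
  have h1 : HasDerivAt (fun x => (x, z.2)) ((1 : ℝ), (0 : ℝ)) z.1 :=
    (hasDerivAt_id z.1).prodMk (hasDerivAt_const z.1 z.2)
  have h2 : HasFDerivAt (doubleSum c) (fderiv ℝ (doubleSum c) z) (z.1, z.2) :=
    han.differentiableAt.hasFDerivAt
  have h3 := h2.comp_hasDerivAt z.1 h1
  rw [h3.unique hD, hz]

theorem GeometricBound.fderiv_snd {c : ℕ → ℕ → ℝ} (hc : GeometricBound c) :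
    ∀ᶠ z in 𝓝 (0 : ℝ × ℝ), z.2 * fderiv ℝ (doubleSum c) z (0, 1)
      = doubleSum (fun a b => b * c a b) z := by
  have hswap : Tendsto (Prod.swap : ℝ × ℝ → ℝ × ℝ) (𝓝 0) (𝓝 0) :=
    continuous_swap.tendsto' _ _ rfl
  filter_upwards [hswap.eventually hc.swap.hasDerivAt, hc.analyticAt.eventually_analyticAt]
    with z ⟨D, hD, hz⟩ han
  have h1 : HasDerivAt (fun y => (z.1, y)) ((0 : ℝ), (1 : ℝ)) z.2 :=
    (hasDerivAt_const z.2 z.1).prodMk (hasDerivAt_id z.2)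
  have h2 : HasFDerivAt (doubleSum c) (fderiv ℝ (doubleSum c) z) (z.1, z.2) :=
    han.differentiableAt.hasFDerivAt
  have h3 := h2.comp_hasDerivAt z.2 h1
  have h4 : (fun y => doubleSum (fun a b => c b a) (y, z.1)) = fun y => doubleSum c (z.1, y) :=
    funext fun y => doubleSum_swap c (z.1, y)
  simp only [Prod.fst_swap, Prod.snd_swap] at hD hz
  rw [h4] at hD
  have h5 := h3.unique hD
  rw [h5, hz]
  exact doubleSum_swap (fun a b => b * c a b) z

end DoubleSeries

/-! ### Quasi-homogeneous polynomials and their traces on `x = 1`. -/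

section Homogeneous

/-- The polynomial `p (1, w)` in the single variable `w`. -/
noncomputable def dehomogenize (p : MvPolynomial (Fin 2) ℝ) : Polynomial ℝ :=
  MvPolynomial.aeval ![1, Polynomial.X] p

theorem eval_dehomogenize (p : MvPolynomial (Fin 2) ℝ) (w : ℝ) :
    (dehomogenize p).eval w = evalAt p (1, w) := by
  have h : (Polynomial.aeval w).comp (MvPolynomial.aeval (![1, Polynomial.X] : Fin 2 → Polynomial ℝ))
      = MvPolynomial.aeval (R := ℝ) (![1, w] : Fin 2 → ℝ) := by
    ext i
    fin_cases i <;> simp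
  have := DFunLike.congr_fun h p
  rw [AlgHom.comp_apply, Polynomial.coe_aeval_eq_eval] at this
  rw [dehomogenize, this, evalAt, MvPolynomial.aeval_eq_eval]

theorem IsQuasiHomogeneous.evalAt_mul {t k : ℕ} {p : MvPolynomial (Fin 2) ℝ}
    (hp : IsQuasiHomogeneous (1, t) k p) (x w : ℝ) :
    evalAt p (x, x ^ t * w) = x ^ k * (dehomogenize p).eval w := by
  rw [eval_dehomogenize, evalAt, evalAt, MvPolynomial.eval_eq', MvPolynomial.eval_eq',
    Finset.mul_sum]
  refine Finset.sum_congr rfl fun e he => ?_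
  have hk := hp (MvPolynomial.mem_support_iff.mp he)
  rw [Finsupp.weight_apply, Finsupp.sum_fintype _ _ (by simp)] at hk
  simp only [Fin.sum_univ_two, Matrix.cons_val_zero, Matrix.cons_val_one, smul_eq_mul,
    mul_one] at hk
  simp only [Fin.prod_univ_two, Matrix.cons_val_zero, Matrix.cons_val_one, one_pow, one_mul]
  rw [← hk, mul_pow, ← pow_mul, pow_add, mul_comm t]
  ring

theorem IsQuasiHomogeneous.eq_of_dehomogenize_eq {t k : ℕ} {p q : MvPolynomial (Fin 2) ℝ}
    (hp : IsQuasiHomogeneous (1, t) k p) (hq : IsQuasiHomogeneous (1, t) k q)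
    (h : dehomogenize p = dehomogenize q) : p = q := by
  -- Multiplying by `x` makes the line `x = 0`, not covered by the coordinates `(x, w)`, harmless.
  refine mul_left_cancel₀ (MvPolynomial.X_ne_zero (R := ℝ) (0 : Fin 2)) ?_
  refine MvPolynomial.funext fun z => ?_
  rw [map_mul, map_mul, MvPolynomial.eval_X]
  rcases eq_or_ne (z 0) 0 with h0 | h0
  · simp [h0]
  · have hz : z = ![z 0, z 0 ^ t * (z 1 / z 0 ^ t)] := by
      ext i
      fin_cases i
      · simp
      · simp; field_simp
    have h1 := hp.evalAt_mul (z 0) (z 1 / z 0 ^ t)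
    have h2 := hq.evalAt_mul (z 0) (z 1 / z 0 ^ t)
    rw [h, ← h2, evalAt, evalAt] at h1
    simp only at h1
    rw [← hz] at h1
    rw [h1]

/-- The quasi-homogeneous part of type `(1, t)` and degree `k` of the double power series with
coefficients `c`. -/
noncomputable def slicePoly (t : ℕ) (c : ℕ → ℕ → ℝ) (k : ℕ) : MvPolynomial (Fin 2) ℝ :=
  ∑ b ∈ (Finset.range (k + 1)).filter (fun b => t * b ≤ k),
    MvPolynomial.monomial (Finsupp.single 0 (k - t * b) + Finsupp.single 1 b) (c (k - t * b) b)

theorem isQuasiHomogeneous_slicePoly (t : ℕ) (c : ℕ → ℕ → ℝ) (k : ℕ) :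
    IsQuasiHomogeneous (1, t) k (slicePoly t c k) := by
  refine MvPolynomial.IsWeightedHomogeneous.sum _ _ _ fun b hb => ?_
  refine MvPolynomial.isWeightedHomogeneous_monomial _ _ _ ?_
  have := (Finset.mem_filter.mp hb).2
  rw [map_add, Finsupp.weight_single, Finsupp.weight_single]
  simp [mul_comm b]
  omega

theorem evalAt_slicePoly (t : ℕ) (c : ℕ → ℕ → ℝ) (k : ℕ) (z : ℝ × ℝ) :
    evalAt (slicePoly t c k) z = ∑ b ∈ (Finset.range (k + 1)).filter (fun b => t * b ≤ k),
      doubleTerm c z (k - t * b, b) := by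
  rw [evalAt, slicePoly, map_sum]
  refine Finset.sum_congr rfl fun b _ => ?_
  rw [MvPolynomial.eval_monomial, Finsupp.prod_add_index' (by simp) (by simp [pow_add]),
    Finsupp.prod_single_index (by simp), Finsupp.prod_single_index (by simp)]
  simp [doubleTerm]

theorem coeff_dehomogenize_slicePoly {t : ℕ} (ht : 1 ≤ t) (c : ℕ → ℕ → ℝ) (k b : ℕ) :
    (dehomogenize (slicePoly t c k)).coeff b = if t * b ≤ k then c (k - t * b) b else 0 := by
  have h : dehomogenize (slicePoly t c k) =
      ∑ b ∈ (Finset.range (k + 1)).filter (fun b => t * b ≤ k),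
        Polynomial.monomial b (c (k - t * b) b) := by
    rw [dehomogenize, slicePoly, map_sum]
    refine Finset.sum_congr rfl fun b _ => ?_
    rw [MvPolynomial.aeval_monomial, Finsupp.prod_add_index' (by simp) (by simp [pow_add]),
      Finsupp.prod_single_index (by simp), Finsupp.prod_single_index (by simp)]
    simp [Polynomial.C_mul_X_pow_eq_monomial]
  rw [h, Polynomial.finsetSum_coeff]
  simp only [Polynomial.coeff_monomial]
  rw [Finset.sum_ite_eq']
  have hiff : (b ∈ (Finset.range (k + 1)).filter (fun b => t * b ≤ k)) ↔ t * b ≤ k := by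
    have : b ≤ t * b := Nat.le_mul_of_pos_left b ht
    simp only [Finset.mem_filter, Finset.mem_range]
    omega
  simp only [hiff]

end Homogeneous

/-! ### Passing between analytic identities along `y = x ^ t * w` and formal identities. -/

section Fibers

open PowerSeries

local notation "𝓢" => PowerSeries (Polynomial ℝ)

/-- The series `φ` converges at `x` to `a`. -/
def SumsTo (φ : PowerSeries ℝ) (x a : ℝ) : Prop := HasSum (fun k => coeff k φ * x ^ k) a

theorem SumsTo.add {φ ψ : PowerSeries ℝ} {x a b : ℝ} (hφ : SumsTo φ x a) (hψ : SumsTo ψ x b) :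
    SumsTo (φ + ψ) x (a + b) := by
  have := HasSum.add hφ hψ
  simpa only [SumsTo, map_add, add_mul] using this

theorem SumsTo.mul {φ ψ : PowerSeries ℝ} {x a b : ℝ} (hφ : SumsTo φ x a) (hψ : SumsTo ψ x b) :
    SumsTo (φ * ψ) x (a * b) := by
  have h1 := hφ.summable.norm
  have h2 := hψ.summable.norm
  have h3 := tsum_mul_tsum_eq_tsum_sum_antidiagonal_of_summable_norm h1 h2
  have h4 := (summable_norm_sum_mul_antidiagonal_of_summable_norm h1 h2).of_norm.hasSum
  rw [← h3, hφ.tsum_eq, hψ.tsum_eq] at h4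
  have key : ∀ k, ∑ kl ∈ Finset.HasAntidiagonal.antidiagonal k, coeff kl.1 φ * x ^ kl.1 * (coeff kl.2 ψ * x ^ kl.2)
      = coeff k (φ * ψ) * x ^ k := fun k => by
    rw [coeff_mul, Finset.sum_mul]
    refine Finset.sum_congr rfl fun kl hkl => ?_
    rw [← Finset.HasAntidiagonal.mem_antidiagonal.mp hkl, pow_add]
    ring
  rw [funext key] at h4
  exact h4

theorem sumsTo_C (x a : ℝ) : SumsTo (C a) x a := by
  have := hasSum_single (f := fun k => coeff k (C a) * x ^ k) 0 fun k hk => by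
    simp [coeff_C, hk]
  simpa [SumsTo] using this

theorem SumsTo.pow {φ : PowerSeries ℝ} {x a : ℝ} (hφ : SumsTo φ x a) (s : ℕ) :
    SumsTo (φ ^ s) x (a ^ s) := by
  induction s with
  | zero => simpa using sumsTo_C x 1
  | succ s ih => rw [pow_succ, pow_succ]; exact ih.mul hφ

theorem eq_zero_of_eventually_sumsTo_zero {φ : PowerSeries ℝ}
    (h : ∀ᶠ x in 𝓝[≠] 0, SumsTo φ x 0) : φ = 0 := by
  classical
  -- At `x = 0` the series always sums to its constant term; continuity of the sum then forces this
  -- value to be `0`.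
  let f : ℝ → ℝ := fun x => if x = 0 then coeff 0 φ else 0
  have hf : ∀ᶠ x in 𝓝 0, HasSum (fun k => x ^ k • coeff k φ) (f (0 + x)) := by
    rw [eventually_nhdsWithin_iff] at h
    filter_upwards [h] with x hx
    by_cases h0 : x = 0
    · have := hasSum_single (f := fun k => x ^ k • coeff k φ) 0 fun k hk => by simp [h0, hk]
      simpa [f, h0] using this
    · have := hx h0
      simpa [SumsTo, f, h0, mul_comm] using this
  let p : FormalMultilinearSeries ℝ ℝ ℝ := FormalMultilinearSeries.ofScalars ℝ fun k => coeff k φ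
  have hcoeff : ∀ k, p.coeff k = coeff k φ := fun k => by
    simp [p, FormalMultilinearSeries.coeff_ofScalars]
  have hp : HasFPowerSeriesAt f p 0 := by
    rw [hasFPowerSeriesAt_iff]
    simpa only [hcoeff] using hf
  have h0 : f 0 = 0 := by
    have h1 : Tendsto f (𝓝[≠] 0) (𝓝 (f 0)) := hp.continuousAt.tendsto.mono_left nhdsWithin_le_nhds
    have h2 : Tendsto f (𝓝[≠] 0) (𝓝 0) := by
      refine tendsto_const_nhds.congr' ?_
      filter_upwards [self_mem_nhdsWithin] with x hx
      simp only [Set.mem_compl_iff, Set.mem_singleton_iff] at hx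
      simp [f, hx]
    exact tendsto_nhds_unique h1 h2
  have hf0 : f = 0 := by
    funext x
    by_cases hx : x = 0
    · rw [hx, h0]; rfl
    · simp [f, hx]
  rw [hf0] at hp
  have hp0 := hp.eq_zero
  ext k
  rw [← hcoeff, hp0]
  rfl

/-- The restriction of `φ` to the fiber `w = const`. -/
noncomputable def fiber (w : ℝ) : 𝓢 →+* PowerSeries ℝ :=
  PowerSeries.map (Polynomial.evalRingHom w)

@[simp] theorem coeff_fiber (w : ℝ) (φ : 𝓢) (k : ℕ) :
    coeff k (fiber w φ) = (coeff k φ).eval w := by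
  simp [fiber]

@[simp] theorem fiber_C (w : ℝ) (q : Polynomial ℝ) : fiber w (C q) = C (q.eval w) := by
  simp [fiber]

theorem eq_zero_of_forall_fiber {φ : 𝓢}
    (h : ∀ w : ℝ, ∀ᶠ x in 𝓝[≠] 0, SumsTo (fiber w φ) x 0) : φ = 0 := by
  ext1 k
  refine Polynomial.funext fun w => ?_
  rw [← coeff_fiber, eq_zero_of_eventually_sumsTo_zero (h w)]
  simp

theorem tendsto_curve {t : ℕ} (ht : 1 ≤ t) (w : ℝ) :
    Tendsto (fun x : ℝ => (x, x ^ t * w)) (𝓝 0) (𝓝 0) := by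
  have : Continuous fun x : ℝ => (x, x ^ t * w) := by fun_prop
  refine this.tendsto' _ _ ?_
  simp [Nat.one_le_iff_ne_zero.mp ht]

/-- The double power series with coefficients `c` in the coordinates `(x, w)`, `y = x ^ t * w`. -/
noncomputable def sliceSeries (t : ℕ) (c : ℕ → ℕ → ℝ) : 𝓢 :=
  PowerSeries.mk fun k => dehomogenize (slicePoly t c k)

theorem sumsTo_sliceSeries {t : ℕ} (ht : 1 ≤ t) {c : ℕ → ℕ → ℝ} {x w : ℝ}
    (h : Summable (doubleTerm c (x, x ^ t * w))) :
    SumsTo (fiber w (sliceSeries t c)) x (doubleSum c (x, x ^ t * w)) := by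
  have h1 := hasSum_group h ht
  have key : ∀ k, ∑ b ∈ (Finset.range (k + 1)).filter (fun b => t * b ≤ k),
      doubleTerm c (x, x ^ t * w) (k - t * b, b) = coeff k (fiber w (sliceSeries t c)) * x ^ k := by
    intro k
    rw [← evalAt_slicePoly, (isQuasiHomogeneous_slicePoly t c k).evalAt_mul, coeff_fiber,
      sliceSeries, coeff_mk, mul_comm]
  rw [funext key] at h1
  exact h1

theorem coeff_coeff_sliceSeries {t : ℕ} (ht : 1 ≤ t) (c : ℕ → ℕ → ℝ) (k b : ℕ) :
    (coeff k (sliceSeries t c)).coeff b = if t * b ≤ k then c (k - t * b) b else 0 := by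
  rw [sliceSeries, coeff_mk, coeff_dehomogenize_slicePoly ht]

theorem hasDegreeBound_sliceSeries {t : ℕ} (ht : 1 ≤ t) (c : ℕ → ℕ → ℝ) :
    HasDegreeBound t 0 (sliceSeries t c) := fun k => by
  by_contra! hlt
  rw [zero_add] at hlt
  have h := coeff_coeff_sliceSeries ht c k (coeff k (sliceSeries t c)).natDegree
  rw [if_neg hlt.not_ge] at h
  have : coeff k (sliceSeries t c) = 0 := Polynomial.leadingCoeff_eq_zero.mp h
  simp [this] at hlt

theorem sliceSeries_euler_right {t : ℕ} (ht : 1 ≤ t) (c : ℕ → ℕ → ℝ) :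
    sliceSeries t (fun a b => b * c a b) = C Polynomial.X * wDeriv (sliceSeries t c) := by
  ext k b
  rw [coeff_coeff_sliceSeries ht, coeff_C_mul, coeff_wDeriv]
  rcases b with _ | b
  · simp
  · rw [Polynomial.coeff_X_mul, Polynomial.coeff_derivative, coeff_coeff_sliceSeries ht]
    split_ifs
    · push_cast; ring
    · simp

theorem sliceSeries_euler_left {t : ℕ} (ht : 1 ≤ t) (c : ℕ → ℕ → ℝ) :
    sliceSeries t (fun a b => a * c a b) + (t : 𝓢) * sliceSeries t (fun a b => b * c a b)
      = X * d⁄dX _ (sliceSeries t c) := by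
  have hcast : (t : 𝓢) = C (Polynomial.C (t : ℝ)) := by simp
  ext k b
  rw [hcast, map_add, Polynomial.coeff_add, coeff_C_mul, Polynomial.coeff_C_mul,
    coeff_coeff_sliceSeries ht, coeff_coeff_sliceSeries ht]
  have hX : coeff k (X * d⁄dX _ (sliceSeries t c))
      = Polynomial.C (k : ℝ) * coeff k (sliceSeries t c) := by
    rcases k with _ | k
    · simp
    · rw [coeff_succ_X_mul, coeff_derivative]; simp; ring
  rw [hX, Polynomial.coeff_C_mul, coeff_coeff_sliceSeries ht]
  split_ifs with h
  · rw [Nat.cast_sub h]; push_cast; ring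
  · simp

end Fibers

/-! ### The vector field in the coordinates `(x, w)`. -/

section FieldSeries

open PowerSeries

local notation "𝓢" => PowerSeries (Polynomial ℝ)

/-- The coefficient of `x ∂_x` of the field `∑ G_j`, divided by `x ^ n`, in the coordinates
`(x, w)`. -/
noncomputable def fieldFst (n : ℕ) (G : ℕ → MvPolynomial (Fin 2) ℝ × MvPolynomial (Fin 2) ℝ) : 𝓢 :=
  PowerSeries.mk fun j => dehomogenize (G (j + n)).1

/-- The second component of the field `∑ G_j`, divided by `x ^ (2 n + 1)`, in the coordinates
`(x, w)`. -/
noncomputable def fieldSnd (n : ℕ) (G : ℕ → MvPolynomial (Fin 2) ℝ × MvPolynomial (Fin 2) ℝ) : 𝓢 :=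
  PowerSeries.mk fun j => dehomogenize (G (j + n)).2

/-- The coefficient of `∂_w` of the field `∑ G_j`, divided by `x ^ n`, in the coordinates
`(x, w)`. -/
noncomputable def fieldW (n : ℕ) (G : ℕ → MvPolynomial (Fin 2) ℝ × MvPolynomial (Fin 2) ℝ) : 𝓢 :=
  fieldSnd n G - ((n + 1 : ℕ) : 𝓢) * C Polynomial.X * fieldFst n G

variable {n : ℕ} {F : ℝ × ℝ → ℝ × ℝ}
  {G : ℕ → MvPolynomial (Fin 2) ℝ × MvPolynomial (Fin 2) ℝ}

theorem hasSum_shift {f g : ℕ → ℝ} {n : ℕ} {a r : ℝ} (hf : HasSum f a) (hlt : ∀ j < n, f j = 0)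
    (hr : r ≠ 0) (hg : ∀ j, f (j + n) = r * g j) : HasSum g (a / r) := by
  have h := (hasSum_nat_add_iff' n).mpr hf
  rw [Finset.sum_eq_zero fun j hj => hlt j (Finset.mem_range.mp hj), sub_zero] at h
  have h2 := h.div_const r
  have key : ∀ j, f (j + n) / r = g j := fun j => by rw [hg]; field_simp
  rw [funext key] at h2
  exact h2

theorem IsFieldExpansion.sumsTo (hG : IsFieldExpansion (1, n + 1) n F G) {x w : ℝ} (hx : x ≠ 0)
    (h : HasSum (fun j => (evalAt (G j).1 (x, x ^ (n + 1) * w), evalAt (G j).2 (x, x ^ (n + 1) * w)))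
      (F (x, x ^ (n + 1) * w))) :
    SumsTo (fiber w (fieldFst n G)) x ((F (x, x ^ (n + 1) * w)).1 / x ^ (n + 1)) ∧
      SumsTo (fiber w (fieldSnd n G)) x ((F (x, x ^ (n + 1) * w)).2 / x ^ (2 * n + 1)) := by
  constructor
  · refine hasSum_shift (n := n) (h.map (AddMonoidHom.fst ℝ ℝ) continuous_fst) (fun j hj => ?_)
      (pow_ne_zero _ hx) fun j => ?_
    · simp [hG.eq_zero_of_lt j hj, evalAt]
    · simp only [Function.comp_apply, AddMonoidHom.coe_fst]
      rw [(hG.quasiHomogeneous (j + n)).1.evalAt_mul, coeff_fiber, fieldFst, coeff_mk]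
      ring
  · refine hasSum_shift (n := n) (h.map (AddMonoidHom.snd ℝ ℝ) continuous_snd) (fun j hj => ?_)
      (pow_ne_zero _ hx) fun j => ?_
    · simp [hG.eq_zero_of_lt j hj, evalAt]
    · simp only [Function.comp_apply, AddMonoidHom.coe_snd]
      rw [(hG.quasiHomogeneous (j + n)).2.evalAt_mul, coeff_fiber, fieldSnd, coeff_mk]
      ring

/-- On each fiber `w = const` all series converge near `0`, so `∇I · F = 0` becomes a vanishing
power series in `x`; since `w` is arbitrary, the polynomial coefficients vanish. -/
theorem twistedDeriv_sliceSeries_eq_zero (hG : IsFieldExpansion (1, n + 1) n F G)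
    {c : ℕ → ℕ → ℝ} (hc : GeometricBound c)
    (hI : ∀ᶠ z in 𝓝 (0 : ℝ × ℝ), fderiv ℝ (doubleSum c) z (F z) = 0) :
    twistedDeriv (fieldFst n G) (fieldW n G) 0 (sliceSeries (n + 1) c) = 0 := by
  have ht : 1 ≤ n + 1 := by omega
  set α := sliceSeries (n + 1) (fun a b => a * c a b) with hα
  set β := sliceSeries (n + 1) (fun a b => b * c a b) with hβ
  have hβw : β = C Polynomial.X * wDeriv (sliceSeries (n + 1) c) := sliceSeries_euler_right ht c
  have hαx : α + ((n + 1 : ℕ) : 𝓢) * β = X * d⁄dX _ (sliceSeries (n + 1) c) :=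
    sliceSeries_euler_left ht c
  -- The extra factor `w` turns `∂_w` into `y ∂_y`, so only the Euler derivatives `α`, `β` occur; it
  -- is cancelled at the end.
  have hcancel : C Polynomial.X * twistedDeriv (fieldFst n G) (fieldW n G) 0
      (sliceSeries (n + 1) c) = C Polynomial.X * fieldFst n G * α + fieldSnd n G * β := by
    rw [twistedDeriv, ← hαx, fieldW]
    push_cast
    linear_combination (-(fieldSnd n G - ((n : 𝓢) + 1) * C Polynomial.X * fieldFst n G)) * hβw
  have hzero : C Polynomial.X * fieldFst n G * α + fieldSnd n G * β = 0 := by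
    refine eq_zero_of_forall_fiber fun w => ?_
    have hcβ : GeometricBound (fun a b => b * c a b) := hc.swap.euler_left.swap
    have hcur := (tendsto_curve ht w).mono_left (nhdsWithin_le_nhds (s := {0}ᶜ))
    filter_upwards [self_mem_nhdsWithin, hcur.eventually hI, hcur.eventually hG.hasSum,
      hcur.eventually hc.euler_left.eventually_summable, hcur.eventually hcβ.eventually_summable,
      hcur.eventually hc.fderiv_fst, hcur.eventually hc.fderiv_snd]
      with x hx hIx hGx hs1 hs2 hd1 hd2
    have hx : x ≠ 0 := hx
    have h1 := sumsTo_sliceSeries ht hs1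
    have h2 := sumsTo_sliceSeries ht hs2
    obtain ⟨h3, h4⟩ := hG.sumsTo hx hGx
    rw [← hd1] at h1
    rw [← hd2] at h2
    have h5 := (((sumsTo_C x w).mul h3).mul h1).add (h4.mul h2)
    rw [map_add, map_mul, map_mul, map_mul, fiber_C, Polynomial.eval_X]
    convert h5 using 1
    set L := fderiv ℝ (doubleSum c) (x, x ^ (n + 1) * w)
    set v := F (x, x ^ (n + 1) * w)
    have hv : v = v.1 • ((1 : ℝ), (0 : ℝ)) + v.2 • ((0 : ℝ), (1 : ℝ)) := by ext <;> simp
    rw [hv, map_add, map_smul, map_smul, smul_eq_mul, smul_eq_mul] at hIx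
    have e : w * (v.1 / x ^ (n + 1)) * (x * L (1, 0))
        + v.2 / x ^ (2 * n + 1) * (x ^ (n + 1) * w * L (0, 1))
        = w / x ^ n * (v.1 * L (1, 0) + v.2 * L (0, 1)) := by
      rw [show x ^ (n + 1) = x ^ n * x by ring, show x ^ (2 * n + 1) = x ^ n * x ^ n * x by ring]
      field_simp
    rw [e, hIx, mul_zero]
  have hX : (C Polynomial.X : 𝓢) ≠ 0 := by
    rw [Ne, map_eq_zero_iff _ C_injective]; exact Polynomial.X_ne_zero
  exact (mul_eq_zero.mp (hcancel.trans hzero)).resolve_left hX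

theorem constantCoeff_fieldFst {d : ℝ} (hlead : G n = leadingField n d) :
    constantCoeff (fieldFst n G) = Polynomial.X + Polynomial.C d := by
  rw [← coeff_zero_eq_constantCoeff_apply, fieldFst, coeff_mk, zero_add, hlead]
  simp [dehomogenize, leadingField]

theorem constantCoeff_fieldW {d : ℝ} (hlead : G n = leadingField n d) :
    constantCoeff (fieldW n G)
      = Polynomial.C ((n + 1 : ℕ) : ℝ) * (1 - Polynomial.X ^ 2) := by
  rw [fieldW, map_sub, map_mul, map_mul, constantCoeff_fieldFst hlead,
    ← coeff_zero_eq_constantCoeff_apply, fieldSnd, coeff_mk, zero_add, hlead]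
  simp [dehomogenize, leadingField]
  ring

end FieldSeries

/-! ### Convergence of the formal root. -/

section RootBound

open PowerSeries

local notation "𝓢" => PowerSeries (Polynomial ℝ)

theorem sum_antidiagonal_geometric (A : ℝ) (m : ℕ) :
    ∑ li ∈ Finset.HasAntidiagonal.antidiagonal m, A * (1 + A) ^ li.2 = (1 + A) ^ (m + 1) - 1 := by
  induction m with
  | zero => simp
  | succ m ih =>
    rw [Finset.Nat.sum_antidiagonal_succ, ih]
    simp only
    ring

theorem coeff_X_mul_derivative {R : Type*} [CommRing R] (φ : PowerSeries R) (k : ℕ) :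
    coeff k (X * d⁄dX R φ) = k * coeff k φ := by
  rcases k with _ | k
  · simp
  · rw [coeff_succ_X_mul, coeff_derivative]; push_cast; ring

/-- The relation `(s + 1) e x y' = x e' y` is a linear recursion for the coefficients of `y`,
solvable because `e₀` is bounded away from `0`. The majorant `(1 + A) ^ j` reproduces itself through
a geometric sum. -/
theorem norm_coeff_le_of_pow_eq {y e : PowerSeries ℂ} {s : ℕ} (hy : y ^ (s + 1) = e) {A r : ℝ}
    (hA : 0 ≤ A) (hr : 0 ≤ r) (he₀ : 1 ≤ ‖coeff 0 e‖) (he : ∀ l, ‖coeff l e‖ ≤ A * r ^ l) (j : ℕ) :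
    ‖coeff j y‖ ≤ ‖coeff 0 y‖ * ((1 + A) * r) ^ j := by
  have hode : e * (((s : PowerSeries ℂ) + 1) * (X * d⁄dX ℂ y)) = (X * d⁄dX ℂ e) * y := by
    have h1 : d⁄dX ℂ e = ((s : PowerSeries ℂ) + 1) * y ^ s * d⁄dX ℂ y := by
      rw [← hy, Derivation.leibniz_pow, Nat.add_sub_cancel, smul_eq_mul, nsmul_eq_mul]
      push_cast
      ring
    rw [h1, ← hy]
    ring
  have hcast : ((s : PowerSeries ℂ) + 1) = C ((s : ℂ) + 1) := by simp
  have hrec : ∀ m, coeff 0 e * (((s : ℂ) + 1) * ((m + 1 : ℕ) * coeff (m + 1) y))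
      = ∑ li ∈ Finset.HasAntidiagonal.antidiagonal m,
        (((li.1 + 1 : ℕ) : ℂ) - ((s : ℂ) + 1) * li.2) * (coeff (li.1 + 1) e * coeff li.2 y) := by
    intro m
    have h := congrArg (coeff (m + 1)) hode
    rw [coeff_mul, coeff_mul, Finset.Nat.sum_antidiagonal_succ,
      Finset.Nat.sum_antidiagonal_succ] at h
    simp only [coeff_X_mul_derivative, hcast, coeff_C_mul, Nat.cast_zero, zero_mul,
      zero_add] at h
    rw [← eq_sub_iff_add_eq, ← Finset.sum_sub_distrib] at h
    rw [h]
    refine Finset.sum_congr rfl fun li _ => ?_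
    ring
  induction j using Nat.strong_induction_on with
  | _ j ih =>
    rcases j with _ | m
    · simp
    · have h := congrArg norm (hrec m)
      have hs : ‖(s : ℂ) + 1‖ = s + 1 := by
        have : ((s : ℂ) + 1) = ((s + 1 : ℕ) : ℂ) := by push_cast; rfl
        rw [this, Complex.norm_natCast]; push_cast; rfl
      rw [norm_mul, norm_mul, norm_mul, hs, Complex.norm_natCast] at h
      have hle : ∀ li ∈ Finset.HasAntidiagonal.antidiagonal m,
          ‖(((li.1 + 1 : ℕ) : ℂ) - ((s : ℂ) + 1) * li.2) * (coeff (li.1 + 1) e * coeff li.2 y)‖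
          ≤ ((s + 1) * (m + 1 : ℕ)) * (‖coeff 0 y‖ * r ^ (m + 1)) * (A * (1 + A) ^ li.2) := by
        intro li hli
        have hm := Finset.HasAntidiagonal.mem_antidiagonal.mp hli
        have h1 : ‖((li.1 + 1 : ℕ) : ℂ) - ((s : ℂ) + 1) * li.2‖ ≤ (s + 1) * (m + 1 : ℕ) := by
          refine (norm_sub_le _ _).trans ?_
          rw [norm_mul, hs, Complex.norm_natCast, Complex.norm_natCast, ← hm]
          push_cast
          nlinarith [mul_nonneg (Nat.cast_nonneg (α := ℝ) s) (Nat.cast_nonneg (α := ℝ) li.1)]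
        have h2 := he (li.1 + 1)
        have h3 := ih li.2 (by omega)
        rw [norm_mul, norm_mul]
        calc _ ≤ ((s + 1) * (m + 1 : ℕ)) * ((A * r ^ (li.1 + 1)) *
              (‖coeff 0 y‖ * ((1 + A) * r) ^ li.2)) := by gcongr
          _ = _ := by rw [← hm, mul_pow]; ring
      have hbound := (h.trans_le (norm_sum_le_of_le _ hle))
      rw [← Finset.mul_sum, sum_antidiagonal_geometric] at hbound
      have hpos : (0 : ℝ) < (s + 1) * (m + 1 : ℕ) := by positivity
      have h1 : ((s + 1) * (m + 1 : ℕ)) * ‖coeff (m + 1) y‖ ≤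
          ((s + 1) * (m + 1 : ℕ)) * (‖coeff 0 y‖ * ((1 + A) * r) ^ (m + 1)) := by
        calc _ ≤ ‖coeff 0 e‖ * ((s + 1) * ((m + 1 : ℕ) * ‖coeff (m + 1) y‖)) := by
              rw [← mul_assoc ((s : ℝ) + 1)]
              exact le_mul_of_one_le_left (by positivity) he₀
          _ ≤ _ := hbound
          _ ≤ ((s + 1) * (m + 1 : ℕ)) * (‖coeff 0 y‖ * r ^ (m + 1)) * (1 + A) ^ (m + 1) := by
              gcongr
              linarith
          _ = _ := by rw [mul_pow]; ring
      exact le_of_mul_le_mul_left h1 hpos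

/-- Cauchy's inequality on the circle of radius `2`, discarding the gain `2 ^ (-b)`. -/
theorem abs_coeff_le_of_norm_aeval_le {q : Polynomial ℝ} {S : ℝ}
    (h : ∀ w : ℂ, ‖w‖ = 2 → ‖Polynomial.aeval w q‖ ≤ S) (b : ℕ) : |q.coeff b| ≤ S := by
  have hiter : ∀ b, ∀ p : Polynomial ℂ, iteratedDeriv b (fun z => p.eval z)
      = fun z => (Polynomial.derivative^[b] p).eval z := by
    intro b
    induction b with
    | zero => intro p; simp
    | succ b ih =>
      intro p
      have : deriv (fun z => p.eval z) = fun z => p.derivative.eval z := by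
        funext z; exact p.deriv
      rw [iteratedDeriv_succ', this, ih, Function.iterate_succ_apply]
  set p := q.map (algebraMap ℝ ℂ) with hp
  have hpe : ∀ z, p.eval z = Polynomial.aeval z q := fun z => by
    rw [hp, Polynomial.eval_map_algebraMap]
  have hC := Complex.norm_iteratedDeriv_le_of_forall_mem_sphere_norm_le (c := 0) (R := 2) (C := S)
    (f := fun z => p.eval z) b (by norm_num) p.differentiable.diffContOnCl fun z hz => by
      rw [hpe]; exact h z (by simpa using hz)
  rw [hiter] at hC
  simp only at hC
  rw [← Polynomial.coeff_zero_eq_eval_zero, Polynomial.coeff_iterate_derivative, zero_add,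
    Nat.descFactorial_self, nsmul_eq_mul, norm_mul, Complex.norm_natCast, hp,
    Polynomial.coeff_map, Complex.coe_algebraMap, Complex.norm_real, Real.norm_eq_abs,
    mul_div_assoc] at hC
  have hfac : (0 : ℝ) < b.factorial := by positivity
  have h1 := le_of_mul_le_mul_left hC hfac
  have hS : 0 ≤ S := (norm_nonneg _).trans (h 2 (by simp))
  exact h1.trans (div_le_self hS (one_le_pow₀ (by norm_num)))

theorem norm_aeval_basePoly {m₁ m₂ : ℕ} {w : ℂ} (hw : ‖w‖ = 2) :
    1 ≤ ‖Polynomial.aeval w (basePoly m₁ m₂)‖ ∧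
      ‖Polynomial.aeval w (basePoly m₁ m₂)‖ ≤ 3 ^ (m₁ + m₂) := by
  have h1 : 1 ≤ ‖w - 1‖ := by
    have := norm_sub_norm_le w 1
    rw [hw, norm_one] at this; linarith
  have h2 : 1 ≤ ‖w + 1‖ := by
    have := norm_sub_norm_le w (-1)
    rw [hw, norm_neg, norm_one, sub_neg_eq_add] at this; linarith
  have h3 : ‖w - 1‖ ≤ 3 := by
    have := norm_sub_le w 1
    rw [hw, norm_one] at this; linarith
  have h4 : ‖w + 1‖ ≤ 3 := by
    have := norm_add_le w 1
    rw [hw, norm_one] at this; linarith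
  have h : ‖Polynomial.aeval w (basePoly m₁ m₂)‖ = ‖w - 1‖ ^ m₁ * ‖w + 1‖ ^ m₂ := by
    simp [basePoly]
  rw [h]
  constructor
  · exact one_le_mul_of_one_le_of_one_le (one_le_pow₀ h1) (one_le_pow₀ h2)
  · rw [pow_add]
    gcongr

theorem norm_aeval_sliceSeries_le {t : ℕ} (ht : 1 ≤ t) {c : ℕ → ℕ → ℝ} {C B : ℝ} (hC : 0 ≤ C)
    (hB : 1 ≤ B) (hc : ∀ a b, |c a b| ≤ C * B ^ (a + b)) {w : ℂ} (hw : ‖w‖ = 2) (k : ℕ) :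
    ‖Polynomial.aeval w (coeff k (sliceSeries t c))‖ ≤ C * (4 * B) ^ k := by
  have hdeg : (coeff k (sliceSeries t c)).natDegree < k + 1 := by
    have h1 := hasDegreeBound_sliceSeries ht c k
    have h2 := Nat.le_mul_of_pos_left (coeff k (sliceSeries t c)).natDegree ht
    omega
  rw [Polynomial.aeval_eq_sum_range' hdeg]
  calc _ ≤ ∑ b ∈ Finset.range (k + 1), C * B ^ k * 2 ^ k := by
        refine norm_sum_le_of_le _ fun b hb => ?_
        have hb' : b ≤ k := by simpa [Nat.lt_succ_iff] using hb
        rw [norm_smul, norm_pow, hw, Real.norm_eq_abs, coeff_coeff_sliceSeries ht]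
        have h1 : |if t * b ≤ k then c (k - t * b) b else 0| ≤ C * B ^ k := by
          split_ifs with h
          · refine (hc _ _).trans ?_
            have : b ≤ t * b := Nat.le_mul_of_pos_left b ht
            gcongr
            omega
          · rw [abs_zero]; positivity
        gcongr
        norm_num
    _ = (k + 1 : ℕ) * (C * B ^ k * 2 ^ k) := by simp
    _ ≤ (2 ^ k : ℕ) * (C * B ^ k * 2 ^ k) := by
        gcongr
        exact Nat.lt_two_pow_self
    _ = C * (4 * B) ^ k := by
        push_cast
        rw [mul_pow, show (4 : ℝ) = 2 * 2 by norm_num, mul_pow]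
        ring

/-- The recursion divides by `e₀ = P ^ (s + 1)`, which vanishes at `w = ±1`. It is therefore run at
complex `w` with `‖w‖ = 2`, where `1 ≤ ‖P(w)‖ ≤ 3 ^ (m₁ + m₂)`. -/
theorem exists_abs_coeff_root_le {t m₁ m₂ s k : ℕ} (ht : 1 ≤ t) {c : ℕ → ℕ → ℝ}
    (hc : GeometricBound c) {γ : ℝ} (hγ : γ ≠ 0) {e y : 𝓢}
    (he : sliceSeries t c = C (Polynomial.C γ) * (X ^ k * e))
    (hy : y ^ (s + 1) = e) (hy₀ : constantCoeff y = basePoly m₁ m₂) :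
    ∃ S K : ℝ, 0 ≤ S ∧ 1 ≤ K ∧ ∀ j b, |(coeff j y).coeff b| ≤ S * K ^ j := by
  obtain ⟨C', B, hC, hB, hc⟩ := hc
  set A := |γ|⁻¹ * (C' * (4 * B) ^ k) with hA
  have hA0 : 0 ≤ A := by positivity
  refine ⟨3 ^ (m₁ + m₂), (1 + A) * (4 * B), by positivity, by nlinarith, fun j b =>
    abs_coeff_le_of_norm_aeval_le (fun w hw => ?_) b⟩
  let Φ : 𝓢 →+* PowerSeries ℂ := PowerSeries.map (Polynomial.aeval w : Polynomial ℝ →ₐ[ℝ] ℂ).toRingHom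
  have hΦ : ∀ (φ : 𝓢) l, coeff l (Φ φ) = Polynomial.aeval w (coeff l φ) := fun φ l => by
    simp [Φ]
  have hyΦ : Φ y ^ (s + 1) = Φ e := by rw [← map_pow, hy]
  have hy₀Φ : coeff 0 (Φ y) = Polynomial.aeval w (basePoly m₁ m₂) := by
    rw [hΦ, coeff_zero_eq_constantCoeff_apply, hy₀]
  have he₀Φ : 1 ≤ ‖coeff 0 (Φ e)‖ := by
    rw [← hyΦ, coeff_zero_eq_constantCoeff_apply, map_pow, ← coeff_zero_eq_constantCoeff_apply,
      hy₀Φ, norm_pow]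
    exact one_le_pow₀ (norm_aeval_basePoly hw).1
  have heΦ : ∀ l, ‖coeff l (Φ e)‖ ≤ A * (4 * B) ^ l := fun l => by
    have h1 := norm_aeval_sliceSeries_le ht hC hB hc hw (l + k)
    rw [he, coeff_C_mul, coeff_X_pow_mul, map_mul, norm_mul, Polynomial.aeval_C,
      Complex.coe_algebraMap, Complex.norm_real, Real.norm_eq_abs, ← hΦ] at h1
    have hγ' : 0 < |γ| := abs_pos.mpr hγ
    calc ‖coeff l (Φ e)‖ = |γ|⁻¹ * (|γ| * ‖coeff l (Φ e)‖) := by field_simp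
      _ ≤ |γ|⁻¹ * (C' * (4 * B) ^ (l + k)) := by gcongr
      _ = _ := by rw [hA, pow_add]; ring
  have h := norm_coeff_le_of_pow_eq hyΦ hA0 (by positivity) he₀Φ heΦ j
  rw [hy₀Φ, hΦ] at h
  refine h.trans ?_
  have := (norm_aeval_basePoly (m₁ := m₁) (m₂ := m₂) hw).2
  gcongr

/-- A series over `ℝ[w]` with the degree bounds of a power series in `x` and `y`, and with
geometrically bounded coefficients, comes from a double power series. -/
theorem exists_sliceSeries_eq {t : ℕ} (ht : 1 ≤ t) {φ : 𝓢} (hφ : HasDegreeBound t 0 φ) {S K : ℝ}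
    (hS : 0 ≤ S) (hK : 1 ≤ K) (hb : ∀ j b, |(coeff j φ).coeff b| ≤ S * K ^ j) :
    ∃ c, GeometricBound c ∧ sliceSeries t c = φ := by
  -- The ratio `K ^ t` comes from `a + t * b ≤ t * (a + b)`.
  refine ⟨fun a b => (coeff (a + t * b) φ).coeff b, ⟨S, K ^ t, hS, one_le_pow₀ hK, fun a b => ?_⟩, ?_⟩
  · refine (hb _ _).trans ?_
    rw [← pow_mul]
    gcongr
    rw [mul_add]
    have : a ≤ t * a := Nat.le_mul_of_pos_left a ht
    omega
  · ext k b
    rw [coeff_coeff_sliceSeries ht]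
    split_ifs with h
    · rw [Nat.sub_add_cancel h]
    · have h1 := hφ k
      refine (Polynomial.coeff_eq_zero_of_natDegree_lt ?_).symm
      by_contra! h2
      have := Nat.mul_le_mul_left t h2
      omega

end RootBound

/-! ### From the formal root to an analytic first integral. -/

section FirstIntegral

open PowerSeries

local notation "𝓢" => PowerSeries (Polynomial ℝ)

theorem coeff_eq_of_sliceSeries_eq_zero {t : ℕ} (ht : 1 ≤ t) {c : ℕ → ℕ → ℝ}
    (h : sliceSeries t c = 0) (a b : ℕ) : c a b = 0 := by
  have := coeff_coeff_sliceSeries ht c (a + t * b) b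
  rw [h, if_pos (Nat.le_add_left _ _), Nat.add_sub_cancel] at this
  simpa using this.symm

theorem doubleSum_zero (c : ℕ → ℕ → ℝ) : doubleSum c 0 = c 0 0 := by
  rw [doubleSum, tsum_eq_single ((0 : ℕ), (0 : ℕ))]
  · simp [doubleTerm]
  · rintro ⟨a, b⟩ hab
    rcases a with _ | a
    · rcases b with _ | b
      · exact absurd rfl hab
      · simp [doubleTerm]
    · simp [doubleTerm]

theorem exists_eq_X_pow_mul {R : Type*} [CommRing R] {φ : PowerSeries R} (h : φ ≠ 0) :
    ∃ k ψ, φ = X ^ k * ψ ∧ constantCoeff ψ ≠ 0 := by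
  classical
  have hex : ∃ k, coeff k φ ≠ 0 := by
    by_contra! hall
    exact h (ext fun k => by simpa using hall k)
  obtain ⟨ψ, hψ⟩ : X ^ Nat.find hex ∣ φ :=
    X_pow_dvd_iff.mpr fun m hm => not_not.mp (Nat.find_min hex hm)
  refine ⟨Nat.find hex, ψ, hψ, ?_⟩
  have h1 := Nat.find_spec hex
  have h2 := congrArg (coeff (Nat.find hex)) hψ
  have h3 : coeff (Nat.find hex) (X ^ Nat.find hex * ψ) = constantCoeff ψ := by
    simpa using coeff_X_pow_mul ψ (Nat.find hex) 0
  rwa [h2, h3] at h1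

theorem twistedDeriv_C_mul (p q : 𝓢) (k : ℕ) (γ : ℝ) (φ : 𝓢) :
    twistedDeriv p q k (C (Polynomial.C γ) * φ) = C (Polynomial.C γ) * twistedDeriv p q k φ := by
  have h : twistedDeriv p q 0 (C (Polynomial.C γ)) = 0 := by
    have h1 : wDeriv (C (Polynomial.C γ)) = 0 := by
      ext1 k; rw [coeff_wDeriv, coeff_C]; split_ifs <;> simp
    have h2 : d⁄dX (Polynomial ℝ) (C (Polynomial.C γ)) = 0 := derivative_C
    rw [twistedDeriv, h1, h2]
    simp
  have := twistedDeriv_mul p q 0 k (C (Polynomial.C γ)) φ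
  rwa [zero_add, h, mul_zero, add_zero] at this

/-- The leading homogeneous part of a nontrivial formal first integral is a constant multiple of
a power of the base polynomial. -/
theorem exists_leading_form {m₁ m₂ t : ℕ} (hm₁ : 1 ≤ m₁)
    (hcop : Nat.Coprime m₁ m₂) (ht : 1 ≤ t) {d : ℝ}
    (hd : d = ((m₁ : ℝ) - (m₂ : ℝ)) / ((m₁ : ℝ) + (m₂ : ℝ))) {p q : 𝓢}
    (hp : constantCoeff p = Polynomial.X + Polynomial.C d)
    (hq : constantCoeff q = Polynomial.C (t : ℝ) * (1 - Polynomial.X ^ 2))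
    {φ : 𝓢} (hφ : HasDegreeBound t 0 φ) (hφ0 : constantCoeff φ = 0) (hne : φ ≠ 0)
    (hD : twistedDeriv p q 0 φ = 0) :
    ∃ (s : ℕ) (γ : ℝ) (e : 𝓢), γ ≠ 0 ∧
      φ = C (Polynomial.C γ) * (X ^ ((s + 1) * (t * (m₁ + m₂))) * e) ∧
      HasDegreeBound t ((s + 1) * (t * (m₁ + m₂))) e ∧
      constantCoeff e = basePoly m₁ m₂ ^ (s + 1) ∧
      twistedDeriv p q ((s + 1) * (t * (m₁ + m₂))) e = 0 := by
  obtain ⟨k, ψ, hψ, hψ0⟩ := exists_eq_X_pow_mul hne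
  have hDψ : twistedDeriv p q k ψ = 0 := by
    rw [hψ, twistedDeriv_X_pow_mul, zero_add] at hD
    exact (mul_eq_zero.mp hD).resolve_left (pow_ne_zero _ X_ne_zero)
  have hdegψ : HasDegreeBound t k ψ := fun j => by
    have := hφ (j + k)
    rw [hψ, coeff_X_pow_mul] at this
    omega
  have hlead : leadingOperator t d k (constantCoeff ψ) = 0 := by
    rw [← constantCoeff_twistedDeriv hp hq, hDψ, map_zero]
  obtain ⟨s, γ, hγ, hk, hform⟩ := eq_C_mul_basePoly_pow_of_leadingOperator_eq_zero hm₁ hcop ht hd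
    hψ0 (by simpa using hdegψ 0) hlead
  rcases s with _ | s
  -- Exponent `0` would mean `k = 0`, hence a nonzero constant coefficient, but `φ` has none.
  · rw [zero_mul] at hk
    rw [hψ, hk, pow_zero, one_mul] at hφ0
    exact absurd hφ0 hψ0
  subst hk
  have hinv : (C (Polynomial.C γ) : 𝓢) * C (Polynomial.C γ⁻¹) = 1 := by
    rw [← map_mul, ← map_mul, mul_inv_cancel₀ hγ]; simp
  refine ⟨s, γ, C (Polynomial.C γ⁻¹) * ψ, hγ, ?_, ?_, ?_, ?_⟩
  · rw [hψ]
    linear_combination (-(X ^ ((s + 1) * (t * (m₁ + m₂))) * ψ)) * hinv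
  · intro j
    rw [coeff_C_mul, Polynomial.natDegree_C_mul (inv_ne_zero hγ)]
    exact hdegψ j
  · rw [map_mul, hform, constantCoeff_C, ← mul_assoc, ← map_mul, inv_mul_cancel₀ hγ]
    simp
  · rw [twistedDeriv_C_mul, hDψ, mul_zero]

theorem isQuasiHomogeneous_leadingIntegral (n m₁ m₂ : ℕ) :
    IsQuasiHomogeneous (1, n + 1) ((n + 1) * (m₁ + m₂)) (leadingIntegral n m₁ m₂) := by
  have hy : IsQuasiHomogeneous (1, n + 1) (n + 1) (MvPolynomial.X 1) := by
    have := MvPolynomial.isWeightedHomogeneous_X ℝ ![1, n + 1] (1 : Fin 2)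
    simpa [IsQuasiHomogeneous] using this
  have hx : IsQuasiHomogeneous (1, n + 1) (n + 1) (MvPolynomial.X 0 ^ (n + 1)) := by
    have := (MvPolynomial.isWeightedHomogeneous_X ℝ ![1, n + 1] (0 : Fin 2)).pow (n + 1)
    simpa [IsQuasiHomogeneous] using this
  have h1 := MvPolynomial.IsWeightedHomogeneous.pow (Submodule.sub_mem
    (MvPolynomial.weightedHomogeneousSubmodule ℝ ![1, n + 1] (n + 1)) hy hx) m₁
  have h2 := MvPolynomial.IsWeightedHomogeneous.pow (Submodule.add_mem
    (MvPolynomial.weightedHomogeneousSubmodule ℝ ![1, n + 1] (n + 1)) hy hx) m₂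
  have h := h1.mul h2
  rw [smul_eq_mul, smul_eq_mul, ← add_mul, mul_comm (m₁ + m₂)] at h
  exact h

theorem dehomogenize_leadingIntegral (n m₁ m₂ : ℕ) :
    dehomogenize (leadingIntegral n m₁ m₂) = basePoly m₁ m₂ := by
  simp [dehomogenize, leadingIntegral, basePoly]

theorem GeometricBound.isScalarExpansion {t M : ℕ} (ht : 1 ≤ t) {c : ℕ → ℕ → ℝ}
    (hc : GeometricBound c) {y : 𝓢} (hy : sliceSeries t c = X ^ M * y) :
    IsScalarExpansion (1, t) M (doubleSum c) (slicePoly t c) where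
  quasiHomogeneous := isQuasiHomogeneous_slicePoly t c
  eq_zero_of_lt j hj := by
    refine (isQuasiHomogeneous_slicePoly t c j).eq_of_dehomogenize_eq
      (MvPolynomial.isWeightedHomogeneous_zero _ _ _) ?_
    have h : coeff j (sliceSeries t c) = 0 := by
      rw [hy, coeff_X_pow_mul', if_neg (by omega)]
    rw [sliceSeries, coeff_mk] at h
    rw [h, dehomogenize, map_zero]
  hasSum := by
    filter_upwards [hc.eventually_summable] with z hz
    simp only [evalAt_slicePoly]
    exact hasSum_group hz ht

theorem dense_fst_ne_zero : Dense {z : ℝ × ℝ | z.1 ≠ 0} :=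
  (dense_compl_singleton (0 : ℝ)).preimage isOpenMap_fst

theorem not_eventually_const {t M : ℕ} (ht : 1 ≤ t) (hM : 1 ≤ M) {c : ℕ → ℕ → ℝ}
    (hc : GeometricBound c) {y : 𝓢} (hy : sliceSeries t c = X ^ M * y) {w : ℝ}
    (hw : (constantCoeff y).eval w ≠ 0) (a : ℝ) : ¬ ∀ᶠ z in 𝓝 (0 : ℝ × ℝ), doubleSum c z = a := by
  intro hconst
  have hcur := (tendsto_curve ht w).mono_left (nhdsWithin_le_nhds (s := {0}ᶜ))
  have hzero : fiber w (sliceSeries t c) + C (-a) = 0 := by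
    refine eq_zero_of_eventually_sumsTo_zero ?_
    filter_upwards [hcur.eventually hconst, hcur.eventually hc.eventually_summable] with x hx hs
    have := (sumsTo_sliceSeries ht hs).add (sumsTo_C x (-a))
    rwa [hx, add_neg_cancel] at this
  have h := congrArg (coeff M) hzero
  have hcM : coeff M (X ^ M * y) = constantCoeff y := by
    simpa using coeff_X_pow_mul y M 0
  rw [map_add, coeff_fiber, hy, hcM, coeff_C, if_neg (by omega), add_zero, map_zero] at h
  exact hw h

theorem doubleSum_eq_of_sliceSeries_eq {t s : ℕ} (ht : 1 ≤ t) {c c' : ℕ → ℕ → ℝ} {γ : ℝ}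
    (h : sliceSeries t c = C (Polynomial.C γ) * sliceSeries t c' ^ s) {z : ℝ × ℝ} (hz : z.1 ≠ 0)
    (hs : Summable (doubleTerm c z)) (hs' : Summable (doubleTerm c' z)) :
    doubleSum c z = γ * doubleSum c' z ^ s := by
  have hzw : z = (z.1, z.1 ^ t * (z.2 / z.1 ^ t)) := by
    ext
    · rfl
    · field_simp
  rw [hzw] at hs hs' ⊢
  have h1 := sumsTo_sliceSeries ht hs
  have h2 := (sumsTo_C z.1 γ).mul ((sumsTo_sliceSeries ht hs').pow s)
  rw [h, map_mul, map_pow, fiber_C, Polynomial.eval_C] at h1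
  exact h1.unique h2

/-- If a first integral is a constant multiple of a power of `J` off the line `x = 0`, then `J` is
a first integral. -/
theorem fderiv_apply_eq_zero_of_pow {F : ℝ × ℝ → ℝ × ℝ} (hF : AnalyticAt ℝ F 0)
    {I J : ℝ × ℝ → ℝ} (hJ : AnalyticAt ℝ J 0) (hJne : ¬ ∀ᶠ z in 𝓝 (0 : ℝ × ℝ), J z = 0)
    (hI : ∀ᶠ z in 𝓝 (0 : ℝ × ℝ), fderiv ℝ I z (F z) = 0) {γ : ℝ} (hγ : γ ≠ 0) {s : ℕ}
    (h : ∀ᶠ z in 𝓝 (0 : ℝ × ℝ), z.1 ≠ 0 → I z = γ * J z ^ (s + 1)) :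
    ∀ᶠ z in 𝓝 (0 : ℝ × ℝ), fderiv ℝ J z (F z) = 0 := by
  have hopen : IsOpen {z : ℝ × ℝ | z.1 ≠ 0} := isOpen_ne_fun continuous_fst continuous_const
  -- Differentiating `γ J ^ (s + 1)` along `F` gives `γ (s + 1) J ^ s dJ(F) = 0`.
  have hmul : ∀ᶠ z in 𝓝 (0 : ℝ × ℝ), z.1 ≠ 0 → fderiv ℝ J z (F z) ≠ 0 → J z = 0 := by
    filter_upwards [h.eventually_nhds, hI, hJ.eventually_analyticAt] with z hz hIz hJz hx hne
    have heq : I =ᶠ[𝓝 z] fun z => γ * J z ^ (s + 1) := by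
      filter_upwards [hz, hopen.mem_nhds hx] with z' h1 h2 using h1 h2
    have hder := (hJz.differentiableAt.hasFDerivAt.pow (s + 1)).const_mul γ
    rw [heq.fderiv_eq, hder.fderiv] at hIz
    simp only [smul_apply, smul_eq_mul, nsmul_eq_mul, Nat.add_sub_cancel] at hIz
    have hs : ((s + 1 : ℕ) : ℝ) ≠ 0 := Nat.cast_ne_zero.mpr (Nat.succ_ne_zero s)
    simp only [mul_eq_zero, hγ, hs, hne, or_false, false_or] at hIz
    exact eq_zero_of_pow_eq_zero hIz
  obtain ⟨ρ, hρ, hball⟩ := Metric.eventually_nhds_iff_ball.mp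
    (hmul.and (hJ.eventually_analyticAt.and hF.eventually_analyticAt))
  filter_upwards [Metric.ball_mem_nhds _ hρ] with z₀ hz₀
  by_contra hne
  -- If `dJ(F)` is nonzero at `z₀`, it is nonzero nearby, so `J` vanishes around some point `z₁` off
  -- the line `x = 0`, and by the identity theorem on the whole ball.
  have hcont : ContinuousAt (fun z => fderiv ℝ J z (F z)) z₀ :=
    ((hball z₀ hz₀).2.1.fderiv.continuousAt).clm_apply (hball z₀ hz₀).2.2.continuousAt
  have hev : ∀ᶠ z in 𝓝 z₀, z ∈ Metric.ball (0 : ℝ × ℝ) ρ ∧ (z.1 ≠ 0 → J z = 0) := by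
    filter_upwards [hcont.eventually_ne hne, Metric.isOpen_ball.mem_nhds hz₀] with z h1 h2
    exact ⟨h2, fun hx => (hball z h2).1 hx h1⟩
  obtain ⟨z₁, hx₁, hz₁⟩ :=
    ((mem_closure_iff_frequently.mp (dense_fst_ne_zero z₀)).and_eventually
      hev.eventually_nhds).exists
  have hJz₁ : J =ᶠ[𝓝 z₁] 0 := by
    filter_upwards [hz₁, hopen.mem_nhds hx₁] with z h1 h2 using h1.2 h2
  have hJan : AnalyticOnNhd ℝ J (Metric.ball 0 ρ) := fun z hz => (hball z hz).2.1
  have := hJan.eqOn_zero_of_preconnected_of_eventuallyEq_zero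
    (convex_ball _ _).isPreconnected hz₁.self_of_nhds.1 hJz₁
  exact hJne (Filter.mem_of_superset (Metric.ball_mem_nhds _ hρ) this)

end FirstIntegral

end NilpotentIntegrability

/-! ### Assembly of the main theorem. -/

theorem mainTheorem5 (n m₁ m₂ : ℕ) (hn : 1 ≤ n) (hm₁ : 1 ≤ m₁) (hm₂ : 1 ≤ m₂)
    (hcop : Nat.Coprime m₁ m₂)
    (d : ℝ) (hd : d = ((m₁ : ℝ) - (m₂ : ℝ)) / ((m₁ : ℝ) + (m₂ : ℝ)))
    (F : ℝ × ℝ → ℝ × ℝ) (hF : AnalyticAt ℝ F 0)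
    (G : ℕ → MvPolynomial (Fin 2) ℝ × MvPolynomial (Fin 2) ℝ)
    (hG : NilpotentIntegrability.IsFieldExpansion (1, n + 1) n F G)
    (hlead : G n = NilpotentIntegrability.leadingField n d)
    (hint : NilpotentIntegrability.IsAnalyticallyIntegrable F) :
    ∃ I : ℝ × ℝ → ℝ, NilpotentIntegrability.IsAnalyticFirstIntegral F I ∧
      ∃ p : ℕ → MvPolynomial (Fin 2) ℝ,
        NilpotentIntegrability.IsScalarExpansion (1, n + 1) ((n + 1) * (m₁ + m₂)) I p ∧
        p ((n + 1) * (m₁ + m₂)) = NilpotentIntegrability.leadingIntegral n m₁ m₂ := by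
  open NilpotentIntegrability PowerSeries in
  obtain ⟨I₀, hI₀⟩ := hint
  have ht : 1 ≤ n + 1 := by omega
  have hM : 1 ≤ (n + 1) * (m₁ + m₂) := Nat.mul_pos (by omega) (by omega)
  obtain ⟨c, hc, hcI⟩ := exists_hasSum_of_analyticAt (hI₀.analyticAt.sub (analyticAt_const (v := I₀ 0)))
  have hcI : (fun z => I₀ z - I₀ 0) =ᶠ[𝓝 0] doubleSum c := hcI
  have hI : ∀ᶠ z in 𝓝 (0 : ℝ × ℝ), fderiv ℝ (doubleSum c) z (F z) = 0 := by
    filter_upwards [hcI.eventuallyEq_nhds, hI₀.derivative_eq_zero] with z h1 h2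
    rw [← h1.fderiv_eq, fderiv_sub_const, h2]
  have hc0 : c 0 0 = 0 := by
    rw [← doubleSum_zero c, ← hcI.self_of_nhds]
    exact sub_self _
  have hne : sliceSeries (n + 1) c ≠ 0 := by
    intro h0
    refine hI₀.not_const ?_
    filter_upwards [hcI] with z hz
    have : doubleSum c z = 0 := by
      simp [doubleSum, doubleTerm, coeff_eq_of_sliceSeries_eq_zero ht h0]
    linarith
  have hconst : constantCoeff (sliceSeries (n + 1) c) = 0 := by
    ext b
    rw [← coeff_zero_eq_constantCoeff_apply, coeff_coeff_sliceSeries ht]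
    rcases b with _ | b
    · simp [hc0]
    · simp
  have hp := constantCoeff_fieldFst hlead
  have hq := constantCoeff_fieldW hlead
  obtain ⟨s, γ, e, hγ, hφ, hdeg, he₀, hDe⟩ := exists_leading_form hm₁ hcop ht hd hp hq
    (hasDegreeBound_sliceSeries ht c) hconst hne (twistedDeriv_sliceSeries_eq_zero hG hc hI)
  obtain ⟨y, hy, hydeg, hy₀⟩ := exists_root_of_twistedDeriv_eq_zero hm₁ hm₂ hd hp hq hdeg he₀ hDe
  obtain ⟨S, K, hS, hK, hb⟩ := exists_abs_coeff_root_le ht hc hγ hφ hy hy₀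
  obtain ⟨c', hc', hslice⟩ : ∃ c', GeometricBound c' ∧
      sliceSeries (n + 1) c' = X ^ ((n + 1) * (m₁ + m₂)) * y := by
    refine exists_sliceSeries_eq ht (fun j => ?_) hS hK fun j b => ?_
    · rw [coeff_X_pow_mul']
      split_ifs with h
      · have := hydeg (j - (n + 1) * (m₁ + m₂))
        omega
      · simp
    · rw [coeff_X_pow_mul']
      split_ifs with h
      · refine (hb _ _).trans ?_
        gcongr
        exact Nat.sub_le _ _
      · simp; positivity
  have hpow : sliceSeries (n + 1) c = C (Polynomial.C γ) * sliceSeries (n + 1) c' ^ (s + 1) := by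
    rw [hslice, hφ, ← hy, mul_pow, ← pow_mul, mul_comm (s + 1)]
  have hroot : ∀ᶠ z in 𝓝 (0 : ℝ × ℝ), z.1 ≠ 0 →
      doubleSum c z = γ * doubleSum c' z ^ (s + 1) := by
    filter_upwards [hc.eventually_summable, hc'.eventually_summable] with z h1 h2 hz
    exact doubleSum_eq_of_sliceSeries_eq ht hpow hz h1 h2
  -- Any `w` other than `±1` would do: along this fiber `J` has a nonzero term of order `M ≥ 1`, so
  -- it is not constant.
  have hw : (constantCoeff y).eval 2 ≠ 0 := by
    rw [hy₀]
    simp [basePoly]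
    norm_num
  have hnc := not_eventually_const ht hM hc' hslice hw
  refine ⟨doubleSum c', ⟨hc'.analyticAt, hnc _,
    fderiv_apply_eq_zero_of_pow hF hc'.analyticAt (hnc 0) hI hγ hroot⟩,
    slicePoly (n + 1) c', hc'.isScalarExpansion ht hslice, ?_⟩
  refine (isQuasiHomogeneous_slicePoly _ _ _).eq_of_dehomogenize_eq
    (isQuasiHomogeneous_leadingIntegral n m₁ m₂) ?_
  have h : coeff ((n + 1) * (m₁ + m₂)) (sliceSeries (n + 1) c') = basePoly m₁ m₂ := by
    rw [hslice, ← hy₀]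
    simpa using coeff_X_pow_mul y ((n + 1) * (m₁ + m₂)) 0
  rw [dehomogenize_leadingIntegral, ← h, sliceSeries, coeff_mk]
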